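/- Let $(M,g)$, $(N,h)$ be smooth Riemannian manifolds (without boundary) of dimensions $m,n$, let $\varphi\colon M\to N$ be a smooth map whose differential is surjective at every point, and let $B\subset N$ be an embedded smooth submanifold of codimension $p$. Let $x\in\varphi^{-1}(B)$ and suppose that $\varphi$ is weakly horizontally conformal to first order at $x$: the $n$ non-zero eigenvalues (with multiplicity) $\mu_1,\dots,\mu_n$ of the first fundamental form $\varphi^*h$ with respect to $g$, regarded as functions near $x$ (for some labelling), are differentiable at $x$ and satisfy $$\mu_1(x)=\dots=\mu_n(x),\qquad \nabla\mu_1(x)=\dots=\nabla\mu_n(x).$$ Then $\varphi^{-1}(B)$ is a submanifold of $M$ of codimension $p$; there is a conformality factor at $x$, i.e. a number $\lambda>0$ with $$\lambda^2 g(v,w)=h(d\varphi\,v,d\varphi\,w)\qquad\text{for all } v,w\in(\ker d\varphi(x))^\perp;$$ and for every number $\lambda$ with this property and every $Z\in T_{\varphi(x)}N$ with $Z\perp T_{\varphi(x)}B$, $$h\Bigl(\frac{\tau_p(\varphi)(x)}{\|d\varphi(x)\|^{p-2}},Z\Bigr)=h\bigl(d\varphi(H_{\varphi^{-1}(B)}(x)),Z\bigr)-h\bigl(\lambda^2H_B(\varphi(x)),Z\bigr).$$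 Here $\|d\varphi\|=\operatorname{Tr}(d\varphi^Td\varphi)^{1/2}$ is the Hilbert–Schmidt norm, and $$\tau_p(\varphi)=\|d\varphi\|^{p-2}\bigl(\tau(\varphi)+(p-2)\,d\varphi(\nabla\ln\|d\varphi\|)\bigr),\qquad \tau(\varphi)=\operatorname{Tr}(\nabla d\varphi),$$ where $(\nabla d\varphi)(v,W)=\nabla^{\varphi^*}_v(d\varphi\,W)-d\varphi(\nabla^M_vW)$, $\nabla^M,\nabla^N$ are the Levi-Civita connections and $\nabla^{\varphi^*}$ is the connection on $\varphi^*TN$ pulled back from $\nabla^N$. The mean curvature vector of a submanifold $S$ at $y\in S$ is taken with the convention $$H_S(y)=-\sum_i(\nabla_{X_i}X_i)^\perp(y),$$ where $X_1,\dots,X_k$ are local smooth vector fields tangent to $S$ along $S$ which at $y$ form an orthonormal basis of $T_yS$, and $\perp$ is the projection to $(T_yS)^\perp$. -/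

import Mathlib

open Manifold Bundle Filter
open scoped Topology ContDiff RealInnerProductSpace

noncomputable section

namespace RiemMap

variable {E : Type*} [NormedAddCommGroup E] [NormedSpace ℝ E] [FiniteDimensional ℝ E]
  {H : Type*} [TopologicalSpace H] (I : ModelWithCorners ℝ E H)
  {M : Type*} [TopologicalSpace M] [ChartedSpace H M]
  {F : Type*} [NormedAddCommGroup F] [NormedSpace ℝ F] [FiniteDimensional ℝ F]
  {G : Type*} [TopologicalSpace G] (J : ModelWithCorners ℝ F G)
  {N : Type*} [TopologicalSpace N] [ChartedSpace G N]

instance instFiniteDimensionalTangentSpace (x : M) : FiniteDimensional ℝ (TangentSpace I x) :=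
  inferInstanceAs (FiniteDimensional ℝ E)

section Connection

variable [IsManifold I 1 M] [RiemannianBundle (fun x : M => TangentSpace I x)]
  [IsManifold J 1 N] [RiemannianBundle (fun x : N => TangentSpace J x)]

instance instCompleteSpaceTangentSpace (x : M) : CompleteSpace (TangentSpace I x) :=
  FiniteDimensional.complete ℝ (TangentSpace I x)

/-- The Christoffel symbol `Γ(v, w) = ∇_v W` at `x` of the Levi-Civita connection. For a tangent
vector `u` at `x`, `FiberBundle.extend E u` is the vector field with constant components in the
preferred chart at `x` (a constant combination of coordinate fields). These fields commute, so the
Koszul formula reads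
`2 ⟪∇_v W, u⟫ = v ⟪W, U⟫ + w ⟪V, U⟫ - u ⟪V, W⟫`; here `u` runs over an orthonormal basis. -/
def christoffel (x : M) (v w : TangentSpace I x) : TangentSpace I x :=
  ∑ k, (2⁻¹ *
    (mvfderiv I (fun y : M => ⟪(FiberBundle.extend E w y : TangentSpace I y),
        FiberBundle.extend E (stdOrthonormalBasis ℝ (TangentSpace I x) k) y⟫) x v
      + mvfderiv I (fun y : M => ⟪(FiberBundle.extend E v y : TangentSpace I y),
        FiberBundle.extend E (stdOrthonormalBasis ℝ (TangentSpace I x) k) y⟫) x w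
      - mvfderiv I (fun y : M => ⟪(FiberBundle.extend E v y : TangentSpace I y),
        FiberBundle.extend E w y⟫) x (stdOrthonormalBasis ℝ (TangentSpace I x) k)))
    • stdOrthonormalBasis ℝ (TangentSpace I x) k

/-- The Levi-Civita derivative `∇_v Y` at `x` of a vector field `Y`, for `v` tangent at `x`:
the derivative of the components of `Y` in the chart at `x`, plus the Christoffel term. -/
def leviCivita (Y : ∀ y : M, TangentSpace I y) (x : M) (v : TangentSpace I x) :
    TangentSpace I x :=
  (trivializationAt E (TangentSpace I) x).symm x
      (mvfderiv I (fun y : M => (trivializationAt E (TangentSpace I) x ⟨y, Y y⟩).2) x v)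
    + christoffel I x v (Y x)

/-- The pulled back Levi-Civita connection of `N` on `φ^* TN`: the derivative `∇^{φ^*}_v s` at `x`
of a section `s` of `φ^* TN` (a vector field along `φ`), for `v` tangent to `M` at `x`. -/
def pullbackConnection (φ : M → N) (s : ∀ y : M, TangentSpace J (φ y)) (x : M)
    (v : TangentSpace I x) : TangentSpace J (φ x) :=
  (trivializationAt F (TangentSpace J) (φ x)).symm (φ x)
      (mvfderiv I (fun y : M => (trivializationAt F (TangentSpace J) (φ x) ⟨φ y, s y⟩).2) x v)
    + christoffel J (φ x) (mfderiv I J φ x v) (s x)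

/-- The second fundamental form of a map,
`(∇dφ)(v, w) = ∇^{φ^*}_v (dφ W) - dφ (∇_v W)` with `W` a vector field extending `w`. -/
def hessian (φ : M → N) (x : M) (v w : TangentSpace I x) : TangentSpace J (φ x) :=
  pullbackConnection I J φ (fun y : M => mfderiv I J φ y (FiberBundle.extend E w y)) x v
    - mfderiv I J φ x (leviCivita I (fun y : M => FiberBundle.extend E w y) x v)

/-- The tension field `τ(φ) = Tr (∇dφ)`. -/
def tension (φ : M → N) (x : M) : TangentSpace J (φ x) :=
  ∑ i, hessian I J φ x (stdOrthonormalBasis ℝ (TangentSpace I x) i)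
    (stdOrthonormalBasis ℝ (TangentSpace I x) i)

/-- The Hilbert-Schmidt norm `‖dφ‖ = (Tr (dφ^T dφ))^(1/2)` at `x`. -/
def normDiff (φ : M → N) (x : M) : ℝ :=
  √(LinearMap.trace ℝ (TangentSpace I x)
    (LinearMap.adjoint (mfderiv I J φ x).toLinearMap ∘ₗ (mfderiv I J φ x).toLinearMap))

/-- The Riemannian gradient of a real function. -/
def grad (f : M → ℝ) (x : M) : TangentSpace I x :=
  (InnerProductSpace.toDual ℝ (TangentSpace I x)).symm (mvfderiv I f x)

/-- The `p`-tension field `τ_p(φ) = ‖dφ‖^(p-2) (τ(φ) + (p-2) dφ(∇ ln ‖dφ‖))`. -/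
def pTension (φ : M → N) (p : ℝ) (x : M) : TangentSpace J (φ x) :=
  normDiff I J φ x ^ (p - 2) •
    (tension I J φ x
      + (p - 2) • mfderiv I J φ x (grad I (fun y : M => Real.log (normDiff I J φ y)) x))

/-- `l` is a conformality factor of `φ` at `x`: `l² ⟪v, w⟫ = ⟪dφ v, dφ w⟫` for all `v, w` in the
horizontal space `(ker dφ)ᗮ`. -/
def IsConformalityFactor (φ : M → N) (x : M) (l : ℝ) : Prop :=
  ∀ v ∈ (LinearMap.ker (mfderiv I J φ x).toLinearMap)ᗮ,
    ∀ w ∈ (LinearMap.ker (mfderiv I J φ x).toLinearMap)ᗮ,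
      l ^ 2 * ⟪v, w⟫ = ⟪mfderiv I J φ x v, mfderiv I J φ x w⟫

/-- `μ` lists (with multiplicity) the non-zero eigenvalues, relative to the metric of `M`, of the
first fundamental form `φ^* h` at `y`: there are `g`-orthonormal eigenvectors `e i` with
`(φ^* h)(e i, v) = μ i g(e i, v)` for all `v`. As `φ^* h` has rank at most `dim N`, a list of length
`dim N` of non-zero eigenvalues is complete. -/
def IsNonzeroSpectrum (φ : M → N) (y : M) (μ : Fin (Module.finrank ℝ F) → ℝ) : Prop :=
  ∃ e : Fin (Module.finrank ℝ F) → TangentSpace I y, Orthonormal ℝ e ∧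
    ∀ i, μ i ≠ 0 ∧ ∀ v : TangentSpace I y,
      ⟪mfderiv I J φ y (e i), mfderiv I J φ y v⟫ = μ i * ⟪e i, v⟫

/-- `φ` (submersive) is weakly horizontally conformal to first order at `x`: the non-zero eigenvalue
functions of `φ^* h`, for some labelling near `x`, are differentiable at `x`, and both their values
and their gradients at `x` agree. -/
def IsWHCFirstOrder (φ : M → N) (x : M) : Prop :=
  ∃ μ : Fin (Module.finrank ℝ F) → M → ℝ,
    (∀ᶠ y in 𝓝 x, IsNonzeroSpectrum I J φ y (fun i => μ i y)) ∧
    (∀ i, MDifferentiableAt I 𝓘(ℝ, ℝ) (μ i) x) ∧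
    ∀ i j, μ i x = μ j x ∧ grad I (μ i) x = grad I (μ j) x

end Connection

section Submanifold

/-- `φ` is a smooth map whose differential is everywhere onto. -/
def IsSubmersive (φ : M → N) : Prop :=
  ContMDiff I J ∞ φ ∧ ∀ x, Function.Surjective (mfderiv I J φ x)

/-- `S` is an (embedded, smooth) submanifold of codimension `p`: near each of its points it is the
zero set of a smooth submersion to `ℝ^p`. -/
def IsSubmanifold (p : ℕ) (S : Set M) : Prop :=
  ∀ x ∈ S, ∃ U : Set M, IsOpen U ∧ x ∈ U ∧ ∃ f : M → EuclideanSpace ℝ (Fin p),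
    ContMDiffOn I (𝓡 p) ∞ f U ∧
    (∀ y ∈ U, Function.Surjective (mfderiv I (𝓡 p) f y)) ∧
    ∀ y ∈ U, y ∈ S ↔ f y = 0

/-- The tangent space `T_x S`: spanned by the velocities at time `0` of the smooth curves in `S`
through `x`. The equation in the tangent bundle says `γ 0 = x` and `γ' 0 = v`. -/
def tangentSpaceOf (S : Set M) (x : M) : Submodule ℝ (TangentSpace I x) :=
  Submodule.span ℝ {v | ∃ γ : ℝ → M, ContMDiffAt 𝓘(ℝ, ℝ) I ∞ γ 0 ∧ (∀ᶠ t in 𝓝 (0 : ℝ), γ t ∈ S) ∧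
    tangentMap 𝓘(ℝ, ℝ) I γ (⟨0, (1 : ℝ)⟩ : TangentBundle 𝓘(ℝ, ℝ) ℝ) =
      (⟨x, v⟩ : TangentBundle I M)}

variable [IsManifold I 1 M] [RiemannianBundle (fun x : M => TangentSpace I x)]

/-- `V` is the mean curvature vector of `S` at `x`, in the convention
`V = -∑ i, (∇_{X i} X i)^⊥` (the negative of the unnormalised trace of the vector-valued second
fundamental form), where the `X i` are smooth vector fields near `x`, tangent to `S` along `S`,
which at `x` form an orthonormal basis of `T_x S`. -/
def IsMeanCurvature (S : Set M) (x : M) (V : TangentSpace I x) : Prop :=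
  ∃ X : Fin (Module.finrank ℝ (tangentSpaceOf I S x)) → ∀ y : M, TangentSpace I y,
    (∀ i, ContMDiffAt I I.tangent ∞ (fun y : M => (⟨y, X i y⟩ : TangentBundle I M)) x) ∧
    (∀ i, ∀ᶠ y in 𝓝 x, y ∈ S → X i y ∈ tangentSpaceOf I S y) ∧
    Orthonormal ℝ (fun i => X i x) ∧
    V = -∑ i, (tangentSpaceOf I S x)ᗮ.starProjection (leviCivita I (X i) x (X i x))

open Classical in
/-- The mean curvature vector `H_S` at `x` (for a submanifold `S` and `x ∈ S` there is exactly one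
vector as in `IsMeanCurvature`). -/
def meanCurvature (S : Set M) (x : M) : TangentSpace I x :=
  if h : ∃ V, IsMeanCurvature I S x V then h.choose else 0

end Submanifold

end RiemMap

end

namespace RiemMap

section ChartBridge

variable {E : Type*} [NormedAddCommGroup E] [NormedSpace ℝ E]
  {M : Type*} [TopologicalSpace M] [ChartedSpace E M]
  {F : Type*} [NormedAddCommGroup F] [NormedSpace ℝ F]

theorem mdifferentiableAt_iff_chart {f : M → F} {x : M} :
    MDifferentiableAt 𝓘(ℝ, E) 𝓘(ℝ, F) f x ↔
      DifferentiableAt ℝ (f ∘ (extChartAt 𝓘(ℝ, E) x).symm) (extChartAt 𝓘(ℝ, E) x x) := by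
  have hw : writtenInExtChartAt 𝓘(ℝ, E) 𝓘(ℝ, F) x f = f ∘ (extChartAt 𝓘(ℝ, E) x).symm := by
    ext; simp only [writtenInExtChartAt, extChartAt_model_space_eq_id, PartialEquiv.refl_coe,
      Function.comp_apply, id]
  rw [mdifferentiableAt_iff, hw]
  simp only [modelWithCornersSelf_coe, Set.range_id, differentiableWithinAt_univ]
  refine ⟨fun h => h.2, fun h => ⟨?_, h⟩⟩
  have h1 : ContinuousAt ((f ∘ (extChartAt 𝓘(ℝ, E) x).symm) ∘ extChartAt 𝓘(ℝ, E) x) x :=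
    h.continuousAt.comp (continuousAt_extChartAt x)
  refine h1.congr ?_
  filter_upwards [extChartAt_source_mem_nhds (I := 𝓘(ℝ, E)) x] with y hy
  simp only [Function.comp_apply, (extChartAt 𝓘(ℝ, E) x).left_inv hy]

theorem mvfderiv_eq_fderiv {f : M → F} {x : M} (hf : MDifferentiableAt 𝓘(ℝ, E) 𝓘(ℝ, F) f x)
    (u : E) :
    mvfderiv 𝓘(ℝ, E) f x u =
      fderiv ℝ (f ∘ (extChartAt 𝓘(ℝ, E) x).symm) (extChartAt 𝓘(ℝ, E) x x) u := by
  have hw : writtenInExtChartAt 𝓘(ℝ, E) 𝓘(ℝ, F) x f = f ∘ (extChartAt 𝓘(ℝ, E) x).symm := by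
    ext; simp only [writtenInExtChartAt, extChartAt_model_space_eq_id, PartialEquiv.refl_coe,
      Function.comp_apply, id]
  rw [hf.mvfderiv, hw]
  simp only [modelWithCornersSelf_coe, Set.range_id, fderivWithin_univ]
  rfl

theorem _root_.Filter.EventuallyEq.mvfderiv_eq {f g : M → F} {x : M} (h : f =ᶠ[𝓝 x] g) :
    mvfderiv 𝓘(ℝ, E) f x = mvfderiv 𝓘(ℝ, E) g x := by
  ext u
  simp only [mvfderiv, h.mfderiv_eq, ContinuousLinearMap.comp_apply]
  rfl

theorem hasFDerivAt_linear_apply [FiniteDimensional ℝ F] {z : E} (B : E → F →ₗ[ℝ] ℝ) (a : E → F)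
    (hB : ∀ v, DifferentiableAt ℝ (fun y => B y v) z) (ha : DifferentiableAt ℝ a z) :
    DifferentiableAt ℝ (fun y => B y (a y)) z ∧
      ∀ u, fderiv ℝ (fun y => B y (a y)) z u =
        fderiv ℝ (fun y => B y (a z)) z u + B z (fderiv ℝ a z u) := by
  let b := Module.finBasis ℝ F
  let C : E → F →L[ℝ] ℝ := fun y => LinearMap.toContinuousLinearMap (B y)
  have hC : C = fun y => ∑ k, B y (b k) • LinearMap.toContinuousLinearMap (b.coord k) := by
    ext y v
    have h := congrArg (B y) (b.sum_repr v)
    rw [map_sum] at h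
    simp [C, ← h, mul_comm]
  have hCd : DifferentiableAt ℝ C z := by
    rw [hC]
    exact DifferentiableAt.fun_sum fun k _ => (hB _).smul_const _
  have key : HasFDerivAt (fun y => B y (a y)) _ z := hCd.hasFDerivAt.clm_apply ha.hasFDerivAt
  have key' : HasFDerivAt (fun y => B y (a z)) _ z :=
    hCd.hasFDerivAt.clm_apply (hasFDerivAt_const (a z) z)
  refine ⟨key.differentiableAt, fun u => ?_⟩
  rw [key.fderiv, key'.fderiv]
  simp [C, add_comm]

theorem mvfderiv_linear_apply [FiniteDimensional ℝ F] {x : M} (B : M → F →ₗ[ℝ] ℝ) (a : M → F)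
    (hB : ∀ v, MDifferentiableAt 𝓘(ℝ, E) 𝓘(ℝ, ℝ) (fun y => B y v) x)
    (ha : MDifferentiableAt 𝓘(ℝ, E) 𝓘(ℝ, F) a x) :
    MDifferentiableAt 𝓘(ℝ, E) 𝓘(ℝ, ℝ) (fun y => B y (a y)) x ∧
      ∀ u, mvfderiv 𝓘(ℝ, E) (fun y => B y (a y)) x u =
        mvfderiv 𝓘(ℝ, E) (fun y => B y (a x)) x u + B x (mvfderiv 𝓘(ℝ, E) a x u) := by
  have hzx : (extChartAt 𝓘(ℝ, E) x).symm (extChartAt 𝓘(ℝ, E) x x) = x :=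
    extChartAt_to_inv x
  have key := hasFDerivAt_linear_apply (fun y => B ((extChartAt 𝓘(ℝ, E) x).symm y))
    (a ∘ (extChartAt 𝓘(ℝ, E) x).symm) (fun v => mdifferentiableAt_iff_chart.1 (hB v))
    (mdifferentiableAt_iff_chart.1 ha)
  have hd : MDifferentiableAt 𝓘(ℝ, E) 𝓘(ℝ, ℝ) (fun y => B y (a y)) x :=
    mdifferentiableAt_iff_chart.2 key.1
  refine ⟨hd, fun u => ?_⟩
  have h := key.2 u
  simp only [Function.comp_apply, hzx] at h
  exact (mvfderiv_eq_fderiv hd u).trans (h.trans (congrArg₂ (· + ·)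
    (mvfderiv_eq_fderiv (hB _) u).symm (congrArg (B x) (mvfderiv_eq_fderiv ha u).symm)))

theorem mvfderiv_bilinear_apply [FiniteDimensional ℝ F] {x : M} (B : M → F →ₗ[ℝ] F →ₗ[ℝ] ℝ)
    (a b : M → F)
    (hB : ∀ v w, MDifferentiableAt 𝓘(ℝ, E) 𝓘(ℝ, ℝ) (fun y => B y v w) x)
    (ha : MDifferentiableAt 𝓘(ℝ, E) 𝓘(ℝ, F) a x)
    (hb : MDifferentiableAt 𝓘(ℝ, E) 𝓘(ℝ, F) b x) :
    MDifferentiableAt 𝓘(ℝ, E) 𝓘(ℝ, ℝ) (fun y => B y (a y) (b y)) x ∧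
      ∀ u, mvfderiv 𝓘(ℝ, E) (fun y => B y (a y) (b y)) x u =
        mvfderiv 𝓘(ℝ, E) (fun y => B y (a x) (b x)) x u
          + B x (mvfderiv 𝓘(ℝ, E) a x u) (b x) + B x (a x) (mvfderiv 𝓘(ℝ, E) b x u) := by
  have h1 := fun v => mvfderiv_linear_apply (fun y => B y v) b (hB v) hb
  have h2 := mvfderiv_linear_apply (fun y => (B y).flip (b y)) a (fun v => (h1 v).1) ha
  refine ⟨h2.1, fun u => ?_⟩
  have h3 := h2.2 u
  simp only [LinearMap.flip_apply] at h3
  rw [h3, (h1 (a x)).2 u]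
  ring

end ChartBridge

section TangentCoordinates

variable {E : Type*} [NormedAddCommGroup E] [NormedSpace ℝ E]
  {M : Type*} [TopologicalSpace M] [ChartedSpace E M] [IsManifold 𝓘(ℝ, E) ∞ M]

theorem trivializationAt_symm_self (x : M) (v : TangentSpace 𝓘(ℝ, E) x) :
    (trivializationAt E (TangentSpace 𝓘(ℝ, E)) x).symm x
      (trivializationAt E (TangentSpace 𝓘(ℝ, E)) x ⟨x, v⟩).2 = v := by
  have h := FiberBundle.extend_apply_self (F := E) v
  exact h

theorem trivializationAt_apply_self (x : M) (v : TangentSpace 𝓘(ℝ, E) x) :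
    (trivializationAt E (TangentSpace 𝓘(ℝ, E)) x ⟨x, v⟩).2 = v := by
  have h := TangentBundle.continuousLinearMapAt_trivializationAt (I := 𝓘(ℝ, E)) (𝕜 := ℝ)
    (mem_chart_source E x)
  rw [mfderiv_extChartAt_self] at h
  have h2 := congrArg (fun l => l v) h
  have hx := FiberBundle.mem_baseSet_trivializationAt' (F := E) (E := TangentSpace 𝓘(ℝ, E)) x
  simp only [Trivialization.continuousLinearMapAt_apply, Trivialization.coe_linearMapAt_of_mem _ hx]
    at h2
  exact h2

theorem eventually_extend_eq (x : M) (v : TangentSpace 𝓘(ℝ, E) x) :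
    ∀ᶠ y in 𝓝 x, (FiberBundle.extend E v y : TangentSpace 𝓘(ℝ, E) y) =
      (trivializationAt E (TangentSpace 𝓘(ℝ, E)) x).symmL ℝ y v := by
  filter_upwards [(trivializationAt E (TangentSpace 𝓘(ℝ, E)) x).open_baseSet.mem_nhds
    (FiberBundle.mem_baseSet_trivializationAt' x)] with y hy
  rw [FiberBundle.extend, trivializationAt_apply_self]
  exact (Trivialization.symmL_apply _ hy _).symm

theorem trivializationAt_symm_apply_self (x : M) (v : TangentSpace 𝓘(ℝ, E) x) :
    (trivializationAt E (TangentSpace 𝓘(ℝ, E)) x).symm x v = v := by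
  have h := trivializationAt_symm_self x v
  rwa [trivializationAt_apply_self] at h

theorem eventually_extend_add (x : M) (v w : TangentSpace 𝓘(ℝ, E) x) :
    ∀ᶠ y in 𝓝 x, (FiberBundle.extend E (v + w) y : TangentSpace 𝓘(ℝ, E) y) =
      FiberBundle.extend E v y + FiberBundle.extend E w y := by
  filter_upwards [eventually_extend_eq x v, eventually_extend_eq x w,
    eventually_extend_eq x (v + w)] with y hv hw hvw
  rw [hv, hw, hvw]
  exact map_add _ _ _

theorem eventually_extend_smul (x : M) (c : ℝ) (v : TangentSpace 𝓘(ℝ, E) x) :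
    ∀ᶠ y in 𝓝 x, (FiberBundle.extend E (c • v) y : TangentSpace 𝓘(ℝ, E) y) =
      c • FiberBundle.extend E v y := by
  filter_upwards [eventually_extend_eq x v, eventually_extend_eq x (c • v)] with y hv hcv
  rw [hv, hcv]
  exact map_smul _ _ _

variable {F : Type*} [NormedAddCommGroup F] [NormedSpace ℝ F]
  {N : Type*} [TopologicalSpace N] [ChartedSpace F N] [IsManifold 𝓘(ℝ, F) ∞ N]

theorem eventually_eq_extend_coord {φ : M → N} {x : M} (hφ : ContinuousAt φ x)
    (s : ∀ y, TangentSpace 𝓘(ℝ, F) (φ y)) :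
    ∀ᶠ y in 𝓝 x, s y = (trivializationAt F (TangentSpace 𝓘(ℝ, F)) (φ x)).symmL ℝ (φ y)
      (trivializationAt F (TangentSpace 𝓘(ℝ, F)) (φ x) ⟨φ y, s y⟩).2 := by
  have h0 := (trivializationAt F (TangentSpace 𝓘(ℝ, F)) (φ x)).open_baseSet.mem_nhds
    (FiberBundle.mem_baseSet_trivializationAt' (φ x))
  filter_upwards [hφ.preimage_mem_nhds h0] with y hy
  rw [Trivialization.symmL_apply _ hy]
  exact ((trivializationAt F (TangentSpace 𝓘(ℝ, F)) (φ x)).symm_apply_apply_mk hy (s y)).symm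

theorem contMDiffAt_mfderiv_apply {n k : WithTop ℕ∞} (hkn : k + 1 ≤ n) {φ : M → N} {x : M}
    (hφ : ContMDiffAt 𝓘(ℝ, E) 𝓘(ℝ, F) n φ x) {X : ∀ y, TangentSpace 𝓘(ℝ, E) y}
    (hX : ContMDiffAt 𝓘(ℝ, E) 𝓘(ℝ, E).tangent k
      (fun y => (⟨y, X y⟩ : TangentBundle 𝓘(ℝ, E) M)) x) :
    ContMDiffAt 𝓘(ℝ, E) 𝓘(ℝ, F).tangent k
      (fun y => (⟨φ y, mfderiv 𝓘(ℝ, E) 𝓘(ℝ, F) φ y (X y)⟩ : TangentBundle 𝓘(ℝ, F) N)) x := by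
  have h := hφ.mfderiv_const hkn
  exact ContMDiffAt.clm_apply_of_inCoordinates h hX (hφ.of_le (le_self_add.trans hkn))

omit [IsManifold 𝓘(ℝ, E) ∞ M] in
theorem contMDiffAt_coord {k : WithTop ℕ∞} {φ : M → N} {x : M}
    {s : ∀ y, TangentSpace 𝓘(ℝ, F) (φ y)}
    (hs : ContMDiffAt 𝓘(ℝ, E) 𝓘(ℝ, F).tangent k
      (fun y => (⟨φ y, s y⟩ : TangentBundle 𝓘(ℝ, F) N)) x) :
    ContMDiffAt 𝓘(ℝ, E) 𝓘(ℝ, F) k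
      (fun y => (trivializationAt F (TangentSpace 𝓘(ℝ, F)) (φ x) ⟨φ y, s y⟩).2) x :=
  (contMDiffAt_totalSpace.1 hs).2

theorem contMDiffAt_extend' {k : WithTop ℕ∞} (hk : k ≤ ∞) (x : M) (v : TangentSpace 𝓘(ℝ, E) x) :
    ContMDiffAt 𝓘(ℝ, E) 𝓘(ℝ, E).tangent k
      (fun y => (⟨y, FiberBundle.extend E v y⟩ : TangentBundle 𝓘(ℝ, E) M)) x := by
  have : IsManifold 𝓘(ℝ, E) (∞ + 1) M := by simpa using ‹IsManifold 𝓘(ℝ, E) ∞ M›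
  have : ContMDiffVectorBundle ∞ E (TangentSpace 𝓘(ℝ, E) : M → Type _) 𝓘(ℝ, E) :=
    TangentBundle.contMDiffVectorBundle
  exact (FiberBundle.contMDiffAt_extend (k := ∞) 𝓘(ℝ, E) E v).of_le hk

omit [IsManifold 𝓘(ℝ, E) ∞ M] [IsManifold 𝓘(ℝ, F) ∞ N] in
theorem mvfderiv_comp_mfderiv {W : Type*} [NormedAddCommGroup W] [NormedSpace ℝ W] {φ : M → N}
    {c : N → W} {x : M} (hc : MDifferentiableAt 𝓘(ℝ, F) 𝓘(ℝ, W) c (φ x))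
    (hφ : MDifferentiableAt 𝓘(ℝ, E) 𝓘(ℝ, F) φ x) (v : TangentSpace 𝓘(ℝ, E) x) :
    mvfderiv 𝓘(ℝ, E) (fun y => c (φ y)) x v =
      mvfderiv 𝓘(ℝ, F) c (φ x) (mfderiv 𝓘(ℝ, E) 𝓘(ℝ, F) φ x v) :=
  mfderiv_comp_apply x hc hφ v

theorem contMDiffAt_mvfderiv_apply {W : Type*} [NormedAddCommGroup W] [NormedSpace ℝ W]
    {n k : WithTop ℕ∞} (hkn : k + 1 ≤ n) {c : M → W} {x : M}
    (hc : ContMDiffAt 𝓘(ℝ, E) 𝓘(ℝ, W) n c x) {X : ∀ y, TangentSpace 𝓘(ℝ, E) y}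
    (hX : ContMDiffAt 𝓘(ℝ, E) 𝓘(ℝ, E).tangent k
      (fun y => (⟨y, X y⟩ : TangentBundle 𝓘(ℝ, E) M)) x) :
    ContMDiffAt 𝓘(ℝ, E) 𝓘(ℝ, W) k (fun y => mvfderiv 𝓘(ℝ, E) c y (X y)) x := by
  have h := contMDiffAt_coord (contMDiffAt_mfderiv_apply hkn hc hX)
  refine h.congr_of_eventuallyEq (Eventually.of_forall fun y => ?_)
  simp
  rfl

end TangentCoordinates

section MetricDerivative

variable {E : Type*} [NormedAddCommGroup E] [NormedSpace ℝ E]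
  {M : Type*} [TopologicalSpace M] [ChartedSpace E M] [IsManifold 𝓘(ℝ, E) ∞ M]
  [RiemannianBundle (fun x : M => TangentSpace 𝓘(ℝ, E) x)]

/-- The derivative at `x`, along `u`, of the metric component `⟪v, w⟫` in the chart at `x`. -/
noncomputable def metricDeriv (x : M) (v w u : TangentSpace 𝓘(ℝ, E) x) : ℝ :=
  mvfderiv 𝓘(ℝ, E) (fun y : M => ⟪(FiberBundle.extend E v y : TangentSpace 𝓘(ℝ, E) y),
    FiberBundle.extend E w y⟫) x u

theorem metricDeriv_comm (x : M) (v w u : TangentSpace 𝓘(ℝ, E) x) :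
    metricDeriv x v w u = metricDeriv x w v u := by
  simp only [metricDeriv]
  congr 2
  exact (funext fun y => real_inner_comm (FiberBundle.extend E w y :
    TangentSpace 𝓘(ℝ, E) y) (FiberBundle.extend E v y))

theorem metricDeriv_add_right (x : M) (v w u u' : TangentSpace 𝓘(ℝ, E) x) :
    metricDeriv x v w (u + u') = metricDeriv x v w u + metricDeriv x v w u' :=
  map_add _ _ _

theorem metricDeriv_smul_right (x : M) (v w u : TangentSpace 𝓘(ℝ, E) x) (c : ℝ) :
    metricDeriv x v w (c • u) = c * metricDeriv x v w u :=
  map_smul _ _ _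

variable [IsContMDiffRiemannianBundle 𝓘(ℝ, E) ∞ E (fun x : M => TangentSpace 𝓘(ℝ, E) x)]

theorem mdifferentiableAt_inner_extend (x : M) (v w : TangentSpace 𝓘(ℝ, E) x) :
    MDifferentiableAt 𝓘(ℝ, E) 𝓘(ℝ, ℝ) (fun y : M => ⟪(FiberBundle.extend E v y :
      TangentSpace 𝓘(ℝ, E) y), FiberBundle.extend E w y⟫) x :=
  MDifferentiableAt.inner_bundle (IB := 𝓘(ℝ, E)) (F := E)
    ((contMDiffAt_extend' (k := 1) (by simp) x v).mdifferentiableAt one_ne_zero)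
    ((contMDiffAt_extend' (k := 1) (by simp) x w).mdifferentiableAt one_ne_zero)

theorem metricDeriv_add_mid (x : M) (v w w' u : TangentSpace 𝓘(ℝ, E) x) :
    metricDeriv x v (w + w') u = metricDeriv x v w u + metricDeriv x v w' u := by
  have h : (fun y : M => ⟪(FiberBundle.extend E v y : TangentSpace 𝓘(ℝ, E) y),
      FiberBundle.extend E (w + w') y⟫) =ᶠ[𝓝 x] fun y =>
      ⟪(FiberBundle.extend E v y : TangentSpace 𝓘(ℝ, E) y), FiberBundle.extend E w y⟫ +
      ⟪(FiberBundle.extend E v y : TangentSpace 𝓘(ℝ, E) y), FiberBundle.extend E w' y⟫ := by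
    filter_upwards [eventually_extend_add x w w'] with y hy
    rw [hy, inner_add_right]
  simp only [metricDeriv, h.mvfderiv_eq]
  rw [mvfderiv_fun_add (mdifferentiableAt_inner_extend x v w)
    (mdifferentiableAt_inner_extend x v w')]
  rfl

theorem metricDeriv_smul_mid (x : M) (v w u : TangentSpace 𝓘(ℝ, E) x) (c : ℝ) :
    metricDeriv x v (c • w) u = c * metricDeriv x v w u := by
  have h : (fun y : M => ⟪(FiberBundle.extend E v y : TangentSpace 𝓘(ℝ, E) y),
      FiberBundle.extend E (c • w) y⟫) =ᶠ[𝓝 x] fun y =>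
      c * ⟪(FiberBundle.extend E v y : TangentSpace 𝓘(ℝ, E) y), FiberBundle.extend E w y⟫ := by
    filter_upwards [eventually_extend_smul x c w] with y hy
    rw [hy, real_inner_smul_right]
  simp only [metricDeriv, h.mvfderiv_eq]
  rw [mvfderiv_fun_mul mdifferentiableAt_const (mdifferentiableAt_inner_extend x v w),
    mvfderiv_const]
  simp

theorem metricDeriv_add_left (x : M) (v v' w u : TangentSpace 𝓘(ℝ, E) x) :
    metricDeriv x (v + v') w u = metricDeriv x v w u + metricDeriv x v' w u := by
  rw [metricDeriv_comm, metricDeriv_add_mid, metricDeriv_comm x w v, metricDeriv_comm x w v']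

theorem metricDeriv_smul_left (x : M) (v w u : TangentSpace 𝓘(ℝ, E) x) (c : ℝ) :
    metricDeriv x (c • v) w u = c * metricDeriv x v w u := by
  rw [metricDeriv_comm, metricDeriv_smul_mid, metricDeriv_comm x w v]

variable [FiniteDimensional ℝ E]

/-- The Koszul formula. -/
theorem inner_christoffel (x : M) (v w u : TangentSpace 𝓘(ℝ, E) x) :
    ⟪christoffel 𝓘(ℝ, E) x v w, u⟫ =
      2⁻¹ * (metricDeriv x w u v + metricDeriv x v u w - metricDeriv x v w u) := by
  let l : TangentSpace 𝓘(ℝ, E) x →ₗ[ℝ] ℝ :=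
    { toFun := fun u => 2⁻¹ * (metricDeriv x w u v + metricDeriv x v u w - metricDeriv x v w u)
      map_add' := fun a b => by
        simp only [metricDeriv_add_mid, metricDeriv_add_right]
        ring
      map_smul' := fun c a => by
        simp only [metricDeriv_smul_mid, metricDeriv_smul_right, RingHom.id_apply, smul_eq_mul]
        ring }
  set b := stdOrthonormalBasis ℝ (TangentSpace 𝓘(ℝ, E) x)
  have h : christoffel 𝓘(ℝ, E) x v w = ∑ k, l (b k) • b k := rfl
  rw [h, sum_inner]
  simp only [real_inner_smul_left]
  change _ = l u
  conv_rhs => rw [← b.sum_repr' u, map_sum]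
  refine Finset.sum_congr rfl fun k _ => ?_
  rw [map_smul, smul_eq_mul, mul_comm]

theorem christoffel_comm (x : M) (v w : TangentSpace 𝓘(ℝ, E) x) :
    christoffel 𝓘(ℝ, E) x v w = christoffel 𝓘(ℝ, E) x w v := by
  refine ext_inner_right ℝ fun u => ?_
  rw [inner_christoffel, inner_christoffel, metricDeriv_comm x v w]
  ring

theorem metricDeriv_eq (x : M) (v w u : TangentSpace 𝓘(ℝ, E) x) :
    metricDeriv x v w u =
      ⟪christoffel 𝓘(ℝ, E) x u v, w⟫ + ⟪v, christoffel 𝓘(ℝ, E) x u w⟫ := by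
  rw [real_inner_comm (christoffel 𝓘(ℝ, E) x u w), inner_christoffel, inner_christoffel,
    metricDeriv_comm x w v u, metricDeriv_comm x u v w, metricDeriv_comm x u w v]
  ring

theorem christoffel_add_left (x : M) (v v' w : TangentSpace 𝓘(ℝ, E) x) :
    christoffel 𝓘(ℝ, E) x (v + v') w =
      christoffel 𝓘(ℝ, E) x v w + christoffel 𝓘(ℝ, E) x v' w := by
  refine ext_inner_right ℝ fun u => ?_
  simp only [inner_add_left, inner_christoffel, metricDeriv_add_left, metricDeriv_add_right]
  ring

theorem christoffel_smul_left (x : M) (c : ℝ) (v w : TangentSpace 𝓘(ℝ, E) x) :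
    christoffel 𝓘(ℝ, E) x (c • v) w = c • christoffel 𝓘(ℝ, E) x v w := by
  refine ext_inner_right ℝ fun u => ?_
  simp only [real_inner_smul_left, inner_christoffel, metricDeriv_smul_left,
    metricDeriv_smul_right]
  ring

theorem christoffel_add_right (x : M) (v w w' : TangentSpace 𝓘(ℝ, E) x) :
    christoffel 𝓘(ℝ, E) x v (w + w') =
      christoffel 𝓘(ℝ, E) x v w + christoffel 𝓘(ℝ, E) x v w' := by
  rw [christoffel_comm, christoffel_add_left, christoffel_comm x w, christoffel_comm x w']

theorem christoffel_smul_right (x : M) (c : ℝ) (v w : TangentSpace 𝓘(ℝ, E) x) :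
    christoffel 𝓘(ℝ, E) x v (c • w) = c • christoffel 𝓘(ℝ, E) x v w := by
  rw [christoffel_comm, christoffel_smul_left, christoffel_comm x w]

end MetricDerivative

section PulledBackConnection

variable {E : Type*} [NormedAddCommGroup E] [NormedSpace ℝ E]
  {M : Type*} [TopologicalSpace M] [ChartedSpace E M]
  {F : Type*} [NormedAddCommGroup F] [NormedSpace ℝ F] [FiniteDimensional ℝ F]
  {N : Type*} [TopologicalSpace N] [ChartedSpace F N] [IsManifold 𝓘(ℝ, F) ∞ N]
  [RiemannianBundle (fun y : N => TangentSpace 𝓘(ℝ, F) y)]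

/-- A vector field `s` along `φ` is differentiable at `x`: its components are. -/
def DiffAlong (φ : M → N) (s : ∀ y, TangentSpace 𝓘(ℝ, F) (φ y)) (x : M) : Prop :=
  MDifferentiableAt 𝓘(ℝ, E) 𝓘(ℝ, F)
    (fun y => (trivializationAt F (TangentSpace 𝓘(ℝ, F)) (φ x) ⟨φ y, s y⟩).2) x

/-- The derivative of the components, in the chart at `φ x`, of a vector field along `φ`. -/
noncomputable def coordDeriv (φ : M → N) (s : ∀ y, TangentSpace 𝓘(ℝ, F) (φ y)) (x : M)
    (u : TangentSpace 𝓘(ℝ, E) x) : TangentSpace 𝓘(ℝ, F) (φ x) :=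
  mvfderiv 𝓘(ℝ, E) (fun y : M =>
    (trivializationAt F (TangentSpace 𝓘(ℝ, F)) (φ x) ⟨φ y, s y⟩).2) x u

theorem pullbackConnection_eq (φ : M → N) (s : ∀ y, TangentSpace 𝓘(ℝ, F) (φ y)) (x : M)
    (u : TangentSpace 𝓘(ℝ, E) x) :
    pullbackConnection 𝓘(ℝ, E) 𝓘(ℝ, F) φ s x u = coordDeriv φ s x u
      + christoffel 𝓘(ℝ, F) (φ x) (mfderiv 𝓘(ℝ, E) 𝓘(ℝ, F) φ x u) (s x) :=
  congrArg (· + christoffel 𝓘(ℝ, F) (φ x) (mfderiv 𝓘(ℝ, E) 𝓘(ℝ, F) φ x u) (s x))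
    (trivializationAt_symm_apply_self (φ x) (coordDeriv φ s x u))

variable [IsContMDiffRiemannianBundle 𝓘(ℝ, F) ∞ F (fun y : N => TangentSpace 𝓘(ℝ, F) y)]

theorem mvfderiv_inner_along {φ : M → N} {s t : ∀ y, TangentSpace 𝓘(ℝ, F) (φ y)} {x : M}
    (hφ : MDifferentiableAt 𝓘(ℝ, E) 𝓘(ℝ, F) φ x)
    (hs : DiffAlong (E := E) φ s x) (ht : DiffAlong (E := E) φ t x) :
    MDifferentiableAt 𝓘(ℝ, E) 𝓘(ℝ, ℝ) (fun y => ⟪s y, t y⟫) x ∧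
    ∀ u, mvfderiv 𝓘(ℝ, E) (fun y => ⟪s y, t y⟫) x u =
      ⟪pullbackConnection 𝓘(ℝ, E) 𝓘(ℝ, F) φ s x u, t x⟫
        + ⟪s x, pullbackConnection 𝓘(ℝ, E) 𝓘(ℝ, F) φ t x u⟫ := by
  set e := trivializationAt F (TangentSpace 𝓘(ℝ, F)) (φ x) with he
  let B : M → F →ₗ[ℝ] F →ₗ[ℝ] ℝ := fun y =>
    LinearMap.mk₂ ℝ (fun v w => ⟪e.symmL ℝ (φ y) v, e.symmL ℝ (φ y) w⟫)
      (fun a b c => by rw [map_add, inner_add_left])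
      (fun a b c => by rw [map_smul, real_inner_smul_left, smul_eq_mul])
      (fun a b c => by rw [map_add, inner_add_right])
      (fun a b c => by rw [map_smul, real_inner_smul_right, smul_eq_mul])
  have hBext : ∀ v w : TangentSpace 𝓘(ℝ, F) (φ x), (fun y => B y v w) =ᶠ[𝓝 x]
      fun y => ⟪(FiberBundle.extend F v (φ y) : TangentSpace 𝓘(ℝ, F) (φ y)),
        FiberBundle.extend F w (φ y)⟫ := by
    intro v w
    filter_upwards [hφ.continuousAt.eventually (eventually_extend_eq (φ x) v),
      hφ.continuousAt.eventually (eventually_extend_eq (φ x) w)] with y hv hw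
    rw [hv, hw]
    rfl
  have hB : ∀ v w, MDifferentiableAt 𝓘(ℝ, E) 𝓘(ℝ, ℝ) (fun y => B y v w) x := fun v w =>
    ((mdifferentiableAt_inner_extend (φ x) v w).comp x hφ).congr_of_eventuallyEq (hBext v w)
  have hBx : ∀ v w : TangentSpace 𝓘(ℝ, F) (φ x), B x v w = ⟪v, w⟫ := by
    intro v w
    have h := (hBext v w).self_of_nhds
    simpa using h
  have hBd : ∀ v w : TangentSpace 𝓘(ℝ, F) (φ x), ∀ u,
      mvfderiv 𝓘(ℝ, E) (fun y => B y v w) x u =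
        metricDeriv (φ x) v w (mfderiv 𝓘(ℝ, E) 𝓘(ℝ, F) φ x u) := by
    intro v w u
    rw [(hBext v w).mvfderiv_eq]
    exact mvfderiv_comp_mfderiv (mdifferentiableAt_inner_extend (φ x) v w) hφ u
  have heq : (fun y => ⟪s y, t y⟫) =ᶠ[𝓝 x]
      fun y => B y (e ⟨φ y, s y⟩).2 (e ⟨φ y, t y⟩).2 := by
    filter_upwards [eventually_eq_extend_coord hφ.continuousAt s,
      eventually_eq_extend_coord hφ.continuousAt t] with y hsy hty
    conv_lhs => rw [hsy, hty]
    rfl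
  obtain ⟨h1, h2⟩ := mvfderiv_bilinear_apply B _ _ hB hs ht
  refine ⟨h1.congr_of_eventuallyEq heq, fun u => ?_⟩
  have h4 := h2 u
  have hsx : (e ⟨φ x, s x⟩).2 = s x := trivializationAt_apply_self _ _
  have htx : (e ⟨φ x, t x⟩).2 = t x := trivializationAt_apply_self _ _
  rw [hsx, htx] at h4
  have h3 := hBd (s x) (t x) u
  rw [metricDeriv_eq] at h3
  have h5 := hBx (coordDeriv φ s x u) (t x)
  have h6 := hBx (s x) (coordDeriv φ t x u)
  rw [heq.mvfderiv_eq, pullbackConnection_eq, pullbackConnection_eq, inner_add_left,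
    inner_add_right, ← h5, ← h6]
  refine h4.trans ?_
  rw [h3]
  simp only [coordDeriv]
  ring

end PulledBackConnection

section HessianOfFunction

variable {E : Type*} [NormedAddCommGroup E] [NormedSpace ℝ E]
  {M : Type*} [TopologicalSpace M] [ChartedSpace E M] [IsManifold 𝓘(ℝ, E) ∞ M]
  {F : Type*} [NormedAddCommGroup F] [NormedSpace ℝ F] [FiniteDimensional ℝ F]
  {N : Type*} [TopologicalSpace N] [ChartedSpace F N] [IsManifold 𝓘(ℝ, F) ∞ N]
  [RiemannianBundle (fun y : N => TangentSpace 𝓘(ℝ, F) y)]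

/-- The Riemannian Hessian of a real function. -/
noncomputable def hessFun (c : N → ℝ) (z : N) (v w : TangentSpace 𝓘(ℝ, F) z) : ℝ :=
  mvfderiv 𝓘(ℝ, F) (fun y => mvfderiv 𝓘(ℝ, F) c y (FiberBundle.extend F w y)) z v
    - mvfderiv 𝓘(ℝ, F) c z (christoffel 𝓘(ℝ, F) z v w)

omit [FiniteDimensional ℝ F] [RiemannianBundle (fun y : N => TangentSpace 𝓘(ℝ, F) y)] in
theorem mdifferentiableAt_mvfderiv_extend {c : N → ℝ} {z : N}
    (hc : ContMDiffAt 𝓘(ℝ, F) 𝓘(ℝ, ℝ) ∞ c z) (w : TangentSpace 𝓘(ℝ, F) z) :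
    MDifferentiableAt 𝓘(ℝ, F) 𝓘(ℝ, ℝ)
      (fun y => mvfderiv 𝓘(ℝ, F) c y (FiberBundle.extend F w y)) z :=
  (contMDiffAt_mvfderiv_apply (k := 1) (n := ∞) (by norm_cast) hc
    (contMDiffAt_extend' (by simp) z w)).mdifferentiableAt one_ne_zero

omit [IsManifold 𝓘(ℝ, E) ∞ M] in
theorem mvfderiv_mvfderiv_along {φ : M → N} {s : ∀ y, TangentSpace 𝓘(ℝ, F) (φ y)} {x : M}
    (hφ : MDifferentiableAt 𝓘(ℝ, E) 𝓘(ℝ, F) φ x) (hs : DiffAlong (E := E) φ s x)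
    {c : N → ℝ} (hc : ContMDiffAt 𝓘(ℝ, F) 𝓘(ℝ, ℝ) ∞ c (φ x)) :
    MDifferentiableAt 𝓘(ℝ, E) 𝓘(ℝ, ℝ) (fun y => mvfderiv 𝓘(ℝ, F) c (φ y) (s y)) x ∧
    ∀ u, mvfderiv 𝓘(ℝ, E) (fun y => mvfderiv 𝓘(ℝ, F) c (φ y) (s y)) x u =
      hessFun c (φ x) (mfderiv 𝓘(ℝ, E) 𝓘(ℝ, F) φ x u) (s x)
        + mvfderiv 𝓘(ℝ, F) c (φ x) (pullbackConnection 𝓘(ℝ, E) 𝓘(ℝ, F) φ s x u) := by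
  set e := trivializationAt F (TangentSpace 𝓘(ℝ, F)) (φ x) with he
  let B : M → F →ₗ[ℝ] ℝ := fun y =>
    (mvfderiv 𝓘(ℝ, F) c (φ y)).toLinearMap ∘ₗ (e.symmL ℝ (φ y)).toLinearMap
  have hBext : ∀ v : TangentSpace 𝓘(ℝ, F) (φ x), (fun y => B y v) =ᶠ[𝓝 x]
      fun y => mvfderiv 𝓘(ℝ, F) c (φ y) (FiberBundle.extend F v (φ y)) := by
    intro v
    filter_upwards [hφ.continuousAt.eventually (eventually_extend_eq (φ x) v)] with y hv
    rw [hv]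
    rfl
  have hB : ∀ v, MDifferentiableAt 𝓘(ℝ, E) 𝓘(ℝ, ℝ) (fun y => B y v) x := fun v =>
    ((mdifferentiableAt_mvfderiv_extend hc v).comp x hφ).congr_of_eventuallyEq (hBext v)
  have hBx : ∀ v : TangentSpace 𝓘(ℝ, F) (φ x), B x v = mvfderiv 𝓘(ℝ, F) c (φ x) v := by
    intro v
    have h := (hBext v).self_of_nhds
    simpa using h
  have heq : (fun y => mvfderiv 𝓘(ℝ, F) c (φ y) (s y)) =ᶠ[𝓝 x]
      fun y => B y (e ⟨φ y, s y⟩).2 := by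
    filter_upwards [eventually_eq_extend_coord hφ.continuousAt s] with y hsy
    conv_lhs => rw [hsy]
    rfl
  obtain ⟨h1, h2⟩ := mvfderiv_linear_apply B _ hB hs
  refine ⟨h1.congr_of_eventuallyEq heq, fun u => ?_⟩
  have h4 := h2 u
  have hsx : (e ⟨φ x, s x⟩).2 = s x := trivializationAt_apply_self _ _
  rw [hsx] at h4
  have h3 : mvfderiv 𝓘(ℝ, E) (fun y => B y (s x)) x u = _ :=
    (congrArg (fun l => l u) (hBext (s x)).mvfderiv_eq).trans
      (mvfderiv_comp_mfderiv (mdifferentiableAt_mvfderiv_extend hc (s x)) hφ u)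
  have h5 := hBx (coordDeriv φ s x u)
  rw [heq.mvfderiv_eq, pullbackConnection_eq, map_add, ← h5, hessFun]
  refine h4.trans ?_
  rw [h3]
  simp only [coordDeriv]
  ring

theorem leviCivita_eq_pullbackConnection (Y : ∀ y : N, TangentSpace 𝓘(ℝ, F) y) (z : N)
    (v : TangentSpace 𝓘(ℝ, F) z) :
    leviCivita 𝓘(ℝ, F) Y z v = pullbackConnection 𝓘(ℝ, F) 𝓘(ℝ, F) id Y z v := by
  rw [leviCivita, pullbackConnection, mfderiv_id]
  rfl

theorem leviCivita_extend (z : N) (v w : TangentSpace 𝓘(ℝ, F) z) :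
    leviCivita 𝓘(ℝ, F) (fun y => FiberBundle.extend F w y) z v = christoffel 𝓘(ℝ, F) z v w := by
  have h : coordDeriv (E := F) (M := N) id (fun y => FiberBundle.extend F w y) z v = 0 := by
    have h1 : (fun y : N => (trivializationAt F (TangentSpace 𝓘(ℝ, F)) z
        ⟨y, FiberBundle.extend F w y⟩).2) =ᶠ[𝓝 z]
        fun _ => (trivializationAt F (TangentSpace 𝓘(ℝ, F)) z ⟨z, w⟩).2 := by
      filter_upwards [(trivializationAt F (TangentSpace 𝓘(ℝ, F)) z).open_baseSet.mem_nhds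
        (FiberBundle.mem_baseSet_trivializationAt' z)] with y hy
      rw [FiberBundle.extend, Trivialization.apply_mk_symm _ hy]
    have h2 := congrArg (fun l => l v) (h1.mvfderiv_eq (E := F))
    refine h2.trans ?_
    rw [mvfderiv_const]
    rfl
  rw [leviCivita_eq_pullbackConnection, pullbackConnection_eq, h, mfderiv_id, zero_add,
    FiberBundle.extend_apply_self]
  rfl

theorem mvfderiv_mvfderiv_field {X : ∀ y, TangentSpace 𝓘(ℝ, F) y} {z : N}
    (hX : DiffAlong (E := F) (M := N) id X z)
    {c : N → ℝ} (hc : ContMDiffAt 𝓘(ℝ, F) 𝓘(ℝ, ℝ) ∞ c z) :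
    MDifferentiableAt 𝓘(ℝ, F) 𝓘(ℝ, ℝ) (fun y => mvfderiv 𝓘(ℝ, F) c y (X y)) z ∧
    ∀ u, mvfderiv 𝓘(ℝ, F) (fun y => mvfderiv 𝓘(ℝ, F) c y (X y)) z u =
      hessFun c z u (X z) + mvfderiv 𝓘(ℝ, F) c z (leviCivita 𝓘(ℝ, F) X z u) := by
  have h := mvfderiv_mvfderiv_along (φ := id) (s := X) mdifferentiableAt_id hX hc
  refine ⟨h.1, fun u => ?_⟩
  have h2 := h.2 u
  rw [mfderiv_id, ← leviCivita_eq_pullbackConnection] at h2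
  exact h2

variable [IsContMDiffRiemannianBundle 𝓘(ℝ, F) ∞ F (fun y : N => TangentSpace 𝓘(ℝ, F) y)]

theorem hessFun_add_left (c : N → ℝ) (z : N) (v v' w : TangentSpace 𝓘(ℝ, F) z) :
    hessFun c z (v + v') w = hessFun c z v w + hessFun c z v' w := by
  simp only [hessFun, christoffel_add_left, map_add]
  ring

theorem hessFun_smul_left (c : N → ℝ) (z : N) (k : ℝ) (v w : TangentSpace 𝓘(ℝ, F) z) :
    hessFun c z (k • v) w = k • hessFun c z v w := by
  simp only [hessFun, christoffel_smul_left, map_smul, smul_eq_mul]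
  ring

theorem hessFun_add_right {c : N → ℝ} {z : N} (hc : ContMDiffAt 𝓘(ℝ, F) 𝓘(ℝ, ℝ) ∞ c z)
    (v w w' : TangentSpace 𝓘(ℝ, F) z) :
    hessFun c z v (w + w') = hessFun c z v w + hessFun c z v w' := by
  have h : (fun y => mvfderiv 𝓘(ℝ, F) c y (FiberBundle.extend F (w + w') y)) =ᶠ[𝓝 z] fun y =>
      mvfderiv 𝓘(ℝ, F) c y (FiberBundle.extend F w y) +
      mvfderiv 𝓘(ℝ, F) c y (FiberBundle.extend F w' y) := by
    filter_upwards [eventually_extend_add z w w'] with y hy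
    rw [hy, map_add]
  simp only [hessFun, christoffel_add_right, map_add, h.mvfderiv_eq]
  rw [mvfderiv_fun_add (mdifferentiableAt_mvfderiv_extend hc w)
    (mdifferentiableAt_mvfderiv_extend hc w')]
  simp only [add_apply]
  ring

theorem hessFun_smul_right {c : N → ℝ} {z : N} (hc : ContMDiffAt 𝓘(ℝ, F) 𝓘(ℝ, ℝ) ∞ c z) (k : ℝ)
    (v w : TangentSpace 𝓘(ℝ, F) z) :
    hessFun c z v (k • w) = k • hessFun c z v w := by
  have h : (fun y => mvfderiv 𝓘(ℝ, F) c y (FiberBundle.extend F (k • w) y)) =ᶠ[𝓝 z] fun y =>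
      k * mvfderiv 𝓘(ℝ, F) c y (FiberBundle.extend F w y) := by
    filter_upwards [eventually_extend_smul z k w] with y hy
    rw [hy, map_smul, smul_eq_mul]
  simp only [hessFun, christoffel_smul_right, map_smul, h.mvfderiv_eq]
  rw [mvfderiv_fun_mul mdifferentiableAt_const (mdifferentiableAt_mvfderiv_extend hc w),
    mvfderiv_const]
  simp
  ring

/-- The Hessian of a smooth function as a bilinear form. -/
noncomputable def hessForm {c : N → ℝ} {z : N} (hc : ContMDiffAt 𝓘(ℝ, F) 𝓘(ℝ, ℝ) ∞ c z) :
    TangentSpace 𝓘(ℝ, F) z →ₗ[ℝ] TangentSpace 𝓘(ℝ, F) z →ₗ[ℝ] ℝ :=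
  LinearMap.mk₂ ℝ (hessFun c z) (hessFun_add_left c z) (hessFun_smul_left c z)
    (hessFun_add_right hc) (hessFun_smul_right hc)

end HessianOfFunction

theorem fderiv_fderiv_apply {E F : Type*} [NormedAddCommGroup E] [NormedSpace ℝ E]
    [NormedAddCommGroup F] [NormedSpace ℝ F] {f : E → F} {z : E}
    (hf : DifferentiableAt ℝ (fderiv ℝ f) z) (v w : E) :
    fderiv ℝ (fun q => fderiv ℝ f q w) z v = fderiv ℝ (fderiv ℝ f) z v w := by
  rw [fderiv_clm_apply hf (differentiableAt_const w)]
  simp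

section HessianOfMap

variable {E : Type*} [NormedAddCommGroup E] [NormedSpace ℝ E] [FiniteDimensional ℝ E]
  {M : Type*} [TopologicalSpace M] [ChartedSpace E M] [IsManifold 𝓘(ℝ, E) ∞ M]
  {F : Type*} [NormedAddCommGroup F] [NormedSpace ℝ F] [FiniteDimensional ℝ F]
  {N : Type*} [TopologicalSpace N] [ChartedSpace F N] [IsManifold 𝓘(ℝ, F) ∞ N]

omit [FiniteDimensional ℝ E] [FiniteDimensional ℝ F] in
theorem diffAlong_mfderiv_extend {φ : M → N} {x : M} (hφ : ContMDiffAt 𝓘(ℝ, E) 𝓘(ℝ, F) ∞ φ x)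
    (w : TangentSpace 𝓘(ℝ, E) x) :
    DiffAlong (E := E) φ
      (fun y => mfderiv 𝓘(ℝ, E) 𝓘(ℝ, F) φ y (FiberBundle.extend E w y)) x :=
  (contMDiffAt_coord (contMDiffAt_mfderiv_apply (k := 1) (n := ∞) (by norm_cast) hφ
    (contMDiffAt_extend' (by simp) x w))).mdifferentiableAt one_ne_zero

omit [FiniteDimensional ℝ E] [FiniteDimensional ℝ F] in
theorem eventually_mdifferentiableAt {φ : M → N} {x : M}
    (hφ : ContMDiffAt 𝓘(ℝ, E) 𝓘(ℝ, F) ∞ φ x) :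
    ∀ᶠ y in 𝓝 x, MDifferentiableAt 𝓘(ℝ, E) 𝓘(ℝ, F) φ y := by
  have h : ContMDiffAt 𝓘(ℝ, E) 𝓘(ℝ, F) 1 φ x := hφ.of_le (by norm_cast)
  exact ((contMDiffAt_iff_contMDiffAt_nhds (by simp)).1 h).mono
    fun y hy => hy.mdifferentiableAt one_ne_zero

omit [FiniteDimensional ℝ E] [FiniteDimensional ℝ F] in
theorem eventually_coord_mfderiv_extend {φ : M → N} {x : M}
    (hφ : ContMDiffAt 𝓘(ℝ, E) 𝓘(ℝ, F) ∞ φ x) (w : TangentSpace 𝓘(ℝ, E) x) :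
    ∀ᶠ y in 𝓝 x, (trivializationAt F (TangentSpace 𝓘(ℝ, F)) (φ x)
        ⟨φ y, mfderiv 𝓘(ℝ, E) 𝓘(ℝ, F) φ y (FiberBundle.extend E w y)⟩).2 =
      fderiv ℝ (extChartAt 𝓘(ℝ, F) (φ x) ∘ φ ∘ (extChartAt 𝓘(ℝ, E) x).symm)
        (extChartAt 𝓘(ℝ, E) x y) w := by
  have h1 := eventually_mdifferentiableAt hφ
  have h2 : ∀ᶠ y in 𝓝 x, φ y ∈ (chartAt F (φ x)).source :=
    hφ.continuousAt.preimage_mem_nhds (chart_source_mem_nhds F (φ x))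
  filter_upwards [h1, h2, chart_source_mem_nhds E x, eventually_extend_eq x w] with y h1 h2 h3 h4
  have h3' : y ∈ (extChartAt 𝓘(ℝ, E) x).source := by rwa [extChartAt_source]
  have hz : (extChartAt 𝓘(ℝ, E) x).symm (extChartAt 𝓘(ℝ, E) x y) = y :=
    (extChartAt 𝓘(ℝ, E) x).left_inv h3'
  have hb : φ y ∈ (trivializationAt F (TangentSpace 𝓘(ℝ, F)) (φ x)).baseSet := h2
  have hd1 : MDifferentiableAt 𝓘(ℝ, E) 𝓘(ℝ, E) (extChartAt 𝓘(ℝ, E) x).symm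
      (extChartAt 𝓘(ℝ, E) x y) := by
    have := mdifferentiableWithinAt_extChartAt_symm (I := 𝓘(ℝ, E))
      ((extChartAt 𝓘(ℝ, E) x).map_source h3')
    simpa [mdifferentiableWithinAt_univ] using this
  have hd2 : MDifferentiableAt 𝓘(ℝ, E) 𝓘(ℝ, F) φ
      ((extChartAt 𝓘(ℝ, E) x).symm (extChartAt 𝓘(ℝ, E) x y)) := by
    rw [hz]; exact h1
  have hd3 : MDifferentiableAt 𝓘(ℝ, F) 𝓘(ℝ, F) (extChartAt 𝓘(ℝ, F) (φ x))
      (φ ((extChartAt 𝓘(ℝ, E) x).symm (extChartAt 𝓘(ℝ, E) x y))) := by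
    rw [hz]; exact mdifferentiableAt_extChartAt h2
  have e1 := mfderiv_comp_apply (I := 𝓘(ℝ, E)) (extChartAt 𝓘(ℝ, E) x y) hd3
    (hd2.comp _ hd1) w
  have e2 := mfderiv_comp_apply (I := 𝓘(ℝ, E)) (extChartAt 𝓘(ℝ, E) x y) hd2 hd1 w
  rw [mfderiv_eq_fderiv] at e1
  refine Eq.trans ?_ e1.symm
  have e2' := congrArg (mfderiv 𝓘(ℝ, F) 𝓘(ℝ, F) (extChartAt 𝓘(ℝ, F) (φ x))
      (φ ((extChartAt 𝓘(ℝ, E) x).symm (extChartAt 𝓘(ℝ, E) x y)))) e2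
  refine Eq.trans ?_ e2'.symm
  have e3 := TangentBundle.symmL_trivializationAt (I := 𝓘(ℝ, E)) (𝕜 := ℝ) h3
  have e4 := TangentBundle.continuousLinearMapAt_trivializationAt (I := 𝓘(ℝ, F)) (𝕜 := ℝ) h2
  simp only [modelWithCornersSelf_coe, Set.range_id, mfderivWithin_univ] at e3
  rw [h4, e3]
  have e5 : ∀ v, (trivializationAt F (TangentSpace 𝓘(ℝ, F)) (φ x) ⟨φ y, v⟩).2 =
      mfderiv 𝓘(ℝ, F) 𝓘(ℝ, F) (extChartAt 𝓘(ℝ, F) (φ x)) (φ y) v := by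
    intro v
    have e6 := congrArg (fun l => l v) e4
    rw [Trivialization.continuousLinearMapAt_apply,
      Trivialization.coe_linearMapAt_of_mem _ hb] at e6
    exact e6
  rw [e5]
  congr 3 <;> rw [hz]

omit [FiniteDimensional ℝ E] [FiniteDimensional ℝ F] [IsManifold 𝓘(ℝ, E) ∞ M]
  [IsManifold 𝓘(ℝ, F) ∞ N] in
theorem contDiffAt_chart {φ : M → N} {x : M} (hφ : ContMDiffAt 𝓘(ℝ, E) 𝓘(ℝ, F) ∞ φ x) :
    ContDiffAt ℝ ∞ (extChartAt 𝓘(ℝ, F) (φ x) ∘ φ ∘ (extChartAt 𝓘(ℝ, E) x).symm)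
      (extChartAt 𝓘(ℝ, E) x x) := by
  have := (contMDiffAt_iff.1 hφ).2
  rwa [modelWithCornersSelf_coe, Set.range_id, contDiffWithinAt_univ] at this

omit [FiniteDimensional ℝ E] [FiniteDimensional ℝ F] in
theorem coordDeriv_mfderiv_extend {φ : M → N} {x : M}
    (hφ : ContMDiffAt 𝓘(ℝ, E) 𝓘(ℝ, F) ∞ φ x) (v w : TangentSpace 𝓘(ℝ, E) x) :
    coordDeriv φ (fun y => mfderiv 𝓘(ℝ, E) 𝓘(ℝ, F) φ y (FiberBundle.extend E w y)) x v =
      (fderiv ℝ (fderiv ℝ (extChartAt 𝓘(ℝ, F) (φ x) ∘ φ ∘ (extChartAt 𝓘(ℝ, E) x).symm))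
        (extChartAt 𝓘(ℝ, E) x x) : E →L[ℝ] E →L[ℝ] F) v w := by
  have hfd : DifferentiableAt ℝ (fderiv ℝ
      (extChartAt 𝓘(ℝ, F) (φ x) ∘ φ ∘ (extChartAt 𝓘(ℝ, E) x).symm))
      (extChartAt 𝓘(ℝ, E) x x) :=
    ((contDiffAt_chart hφ).fderiv_right (m := 1) (by norm_cast)).differentiableAt one_ne_zero
  refine (mvfderiv_eq_fderiv (diffAlong_mfderiv_extend hφ w) v).trans ?_
  have h3 : Tendsto (extChartAt 𝓘(ℝ, E) x).symm (𝓝 (extChartAt 𝓘(ℝ, E) x x)) (𝓝 x) := by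
    have := continuousAt_extChartAt_symm (I := 𝓘(ℝ, E)) x
    rwa [ContinuousAt, extChartAt_to_inv] at this
  have h2 : (fun y => (trivializationAt F (TangentSpace 𝓘(ℝ, F))
      (φ x) ⟨φ y, mfderiv 𝓘(ℝ, E) 𝓘(ℝ, F) φ y (FiberBundle.extend E w y)⟩).2) ∘
        (extChartAt 𝓘(ℝ, E) x).symm =ᶠ[𝓝 (extChartAt 𝓘(ℝ, E) x x)]
      fun q => fderiv ℝ (extChartAt 𝓘(ℝ, F) (φ x) ∘ φ ∘ (extChartAt 𝓘(ℝ, E) x).symm) q w := by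
    filter_upwards [h3.eventually (eventually_coord_mfderiv_extend hφ w),
      extChartAt_target_mem_nhds (I := 𝓘(ℝ, E)) x] with q hq hqt
    rw [(extChartAt 𝓘(ℝ, E) x).right_inv hqt] at hq
    exact hq
  have h4 := congrArg (fun l : E →L[ℝ] F => l v) h2.fderiv_eq
  refine h4.trans ?_
  exact fderiv_fderiv_apply hfd v w

omit [FiniteDimensional ℝ E] [FiniteDimensional ℝ F] in
theorem coordDeriv_mfderiv_extend_comm {φ : M → N} {x : M}
    (hφ : ContMDiffAt 𝓘(ℝ, E) 𝓘(ℝ, F) ∞ φ x) (v w : TangentSpace 𝓘(ℝ, E) x) :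
    coordDeriv φ (fun y => mfderiv 𝓘(ℝ, E) 𝓘(ℝ, F) φ y (FiberBundle.extend E w y)) x v =
      coordDeriv φ (fun y => mfderiv 𝓘(ℝ, E) 𝓘(ℝ, F) φ y (FiberBundle.extend E v y)) x w := by
  have hsymm := (contDiffAt_chart hφ).isSymmSndFDerivAt (by
    rw [minSmoothness_of_isRCLikeNormedField]
    exact ENat.LEInfty.out)
  rw [coordDeriv_mfderiv_extend hφ, coordDeriv_mfderiv_extend hφ]
  exact hsymm v w

variable [RiemannianBundle (fun x : M => TangentSpace 𝓘(ℝ, E) x)]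
  [RiemannianBundle (fun y : N => TangentSpace 𝓘(ℝ, F) y)]

theorem hessian_eq (φ : M → N) (x : M) (v w : TangentSpace 𝓘(ℝ, E) x) :
    hessian 𝓘(ℝ, E) 𝓘(ℝ, F) φ x v w =
      pullbackConnection 𝓘(ℝ, E) 𝓘(ℝ, F) φ
        (fun y => mfderiv 𝓘(ℝ, E) 𝓘(ℝ, F) φ y (FiberBundle.extend E w y)) x v
      - mfderiv 𝓘(ℝ, E) 𝓘(ℝ, F) φ x (christoffel 𝓘(ℝ, E) x v w) := by
  rw [hessian, leviCivita_extend]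

theorem hessFun_comp {φ : M → N} {x : M} (hφ : ContMDiff 𝓘(ℝ, E) 𝓘(ℝ, F) ∞ φ)
    {c : N → ℝ} (hc : ContMDiffAt 𝓘(ℝ, F) 𝓘(ℝ, ℝ) ∞ c (φ x)) (v w : TangentSpace 𝓘(ℝ, E) x) :
    hessFun (fun y => c (φ y)) x v w =
      hessFun c (φ x) (mfderiv 𝓘(ℝ, E) 𝓘(ℝ, F) φ x v) (mfderiv 𝓘(ℝ, E) 𝓘(ℝ, F) φ x w)
        + mvfderiv 𝓘(ℝ, F) c (φ x) (hessian 𝓘(ℝ, E) 𝓘(ℝ, F) φ x v w) := by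
  have hd : ∀ y, MDifferentiableAt 𝓘(ℝ, E) 𝓘(ℝ, F) φ y := fun y =>
    (hφ y).mdifferentiableAt (by simp)
  have hce : ∀ᶠ y in 𝓝 x, MDifferentiableAt 𝓘(ℝ, F) 𝓘(ℝ, ℝ) c (φ y) :=
    (hd x).continuousAt.eventually (eventually_mdifferentiableAt hc)
  have h : (fun y => mvfderiv 𝓘(ℝ, E) (fun y => c (φ y)) y (FiberBundle.extend E w y)) =ᶠ[𝓝 x]
      fun y => mvfderiv 𝓘(ℝ, F) c (φ y)
        (mfderiv 𝓘(ℝ, E) 𝓘(ℝ, F) φ y (FiberBundle.extend E w y)) := by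
    filter_upwards [hce] with y hy
    exact mvfderiv_comp_mfderiv hy (hd y) _
  have h2 := (mvfderiv_mvfderiv_along (hd x) (diffAlong_mfderiv_extend (hφ x) w) hc).2 v
  rw [hessFun, h.mvfderiv_eq, h2, mvfderiv_comp_mfderiv hce.self_of_nhds (hd x), hessian_eq,
    map_sub, FiberBundle.extend_apply_self]
  ring

variable [IsContMDiffRiemannianBundle 𝓘(ℝ, F) ∞ F (fun y : N => TangentSpace 𝓘(ℝ, F) y)]

theorem hessian_comm
    [IsContMDiffRiemannianBundle 𝓘(ℝ, E) ∞ E (fun x : M => TangentSpace 𝓘(ℝ, E) x)]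
    {φ : M → N} {x : M} (hφ : ContMDiffAt 𝓘(ℝ, E) 𝓘(ℝ, F) ∞ φ x)
    (v w : TangentSpace 𝓘(ℝ, E) x) :
    hessian 𝓘(ℝ, E) 𝓘(ℝ, F) φ x v w = hessian 𝓘(ℝ, E) 𝓘(ℝ, F) φ x w v := by
  rw [hessian_eq, hessian_eq, pullbackConnection_eq, pullbackConnection_eq,
    coordDeriv_mfderiv_extend_comm hφ, christoffel_comm x v w]
  simp only [FiberBundle.extend_apply_self]
  rw [christoffel_comm]

/-- The derivative of the first fundamental form in terms of the second fundamental form. -/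
theorem mvfderiv_inner_mfderiv_extend {φ : M → N} {x : M}
    (hφ : ContMDiffAt 𝓘(ℝ, E) 𝓘(ℝ, F) ∞ φ x) (u v w : TangentSpace 𝓘(ℝ, E) x) :
    mvfderiv 𝓘(ℝ, E) (fun y => ⟪mfderiv 𝓘(ℝ, E) 𝓘(ℝ, F) φ y (FiberBundle.extend E v y),
        mfderiv 𝓘(ℝ, E) 𝓘(ℝ, F) φ y (FiberBundle.extend E w y)⟫) x u =
      ⟪hessian 𝓘(ℝ, E) 𝓘(ℝ, F) φ x u v, mfderiv 𝓘(ℝ, E) 𝓘(ℝ, F) φ x w⟫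
        + ⟪mfderiv 𝓘(ℝ, E) 𝓘(ℝ, F) φ x v, hessian 𝓘(ℝ, E) 𝓘(ℝ, F) φ x u w⟫
        + ⟪mfderiv 𝓘(ℝ, E) 𝓘(ℝ, F) φ x (christoffel 𝓘(ℝ, E) x u v),
            mfderiv 𝓘(ℝ, E) 𝓘(ℝ, F) φ x w⟫
        + ⟪mfderiv 𝓘(ℝ, E) 𝓘(ℝ, F) φ x v,
            mfderiv 𝓘(ℝ, E) 𝓘(ℝ, F) φ x (christoffel 𝓘(ℝ, E) x u w)⟫ := by
  have h := (mvfderiv_inner_along (hφ.mdifferentiableAt (by simp))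
    (diffAlong_mfderiv_extend hφ v) (diffAlong_mfderiv_extend hφ w)).2 u
  rw [h, hessian_eq, hessian_eq, inner_sub_left, inner_sub_right]
  simp only [FiberBundle.extend_apply_self]
  ring

end HessianOfMap

theorem exists_curve_of_fderiv_eq_zero {E W : Type*} [NormedAddCommGroup E] [NormedSpace ℝ E]
    [CompleteSpace E] [NormedAddCommGroup W] [NormedSpace ℝ W] [FiniteDimensional ℝ W]
    {f : E → W} {z v : E}
    (hf : ContDiffAt ℝ ∞ f z) (hs : Function.Surjective (fderiv ℝ f z))
    (hv : fderiv ℝ f z v = 0) :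
    ∃ c : ℝ → E, ContDiffAt ℝ ∞ c 0 ∧ c 0 = z ∧ HasDerivAt c v 0 ∧ ∀ᶠ t in 𝓝 0, f (c t) = f z := by
  obtain ⟨R, hR⟩ := (fderiv ℝ f z).exists_rightInverse_of_surjective
    (LinearMap.range_eq_top.2 hs)
  let A : ℝ × W →L[ℝ] E := (ContinuousLinearMap.toSpanSingleton ℝ v).coprod R
  let g : ℝ × W → W := fun q => f (z + A q)
  have hA0 : z + A ((0, 0) : ℝ × W) = z := by simp [A]
  have hf' : ContDiffAt ℝ ∞ f (z + A ((0, 0) : ℝ × W)) := by rwa [hA0]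
  have hg : ContDiffAt ℝ ∞ g (0, 0) :=
    ContDiffAt.comp (f := fun q => z + A q) _ hf' (contDiffAt_const.add A.contDiff.contDiffAt)
  have hgd : fderiv ℝ g (0, 0) = (fderiv ℝ f z).comp A := by
    have h1 : HasFDerivAt f (fderiv ℝ f z) (z + A ((0, 0) : ℝ × W)) := by
      rw [hA0]; exact (hf.differentiableAt (by simp)).hasFDerivAt
    exact (HasFDerivAt.comp (f := fun q => z + A q) _ h1 (A.hasFDerivAt.const_add z)).fderiv
  have hinr : fderiv ℝ g (0, 0) ∘L .inr ℝ ℝ W = ContinuousLinearMap.id ℝ W := by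
    ext w
    have := congrArg (fun l => l w) hR
    simpa [hgd, A] using this
  have hinl : fderiv ℝ g (0, 0) ∘L .inl ℝ ℝ W = 0 := by
    ext
    simp [hgd, A, hv]
  have hinv : (fderiv ℝ g (0, 0) ∘L .inr ℝ ℝ W).IsInvertible := by
    rw [hinr]
    exact ContinuousLinearMap.isInvertible_equiv (f := ContinuousLinearEquiv.refl ℝ W)
  let s : ℝ → W := hg.implicitFunction (by simp) hinv
  have hs0 : s 0 = 0 := hg.implicitFunction_apply_self (by simp) hinv
  have hsc : ContDiffAt ℝ ∞ s 0 := hg.contDiffAt_implicitFunction (by simp) hinv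
  have hsd : HasFDerivAt s (0 : ℝ →L[ℝ] W) 0 := by
    have h := (hg.hasStrictFDerivAt_implicitFunction (by simp) hinv).hasFDerivAt
    rw [hinl, ContinuousLinearMap.comp_zero] at h
    simpa using h
  refine ⟨fun t => z + A (t, s t), ?_, ?_, ?_, ?_⟩
  · exact contDiffAt_const.add (A.contDiff.contDiffAt.comp _ (contDiffAt_id.prodMk hsc))
  · simp [hs0, A]
  · have h : HasDerivAt (fun t : ℝ => (t, s t)) ((1 : ℝ), (0 : W)) 0 :=
      (hasDerivAt_id 0).prodMk hsd.hasDerivAt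
    have h2 := (A.hasFDerivAt.comp_hasDerivAt (0 : ℝ) h).const_add z
    simpa [A] using h2
  · have h := hg.eventually_apply_implicitFunction (by simp) hinv
    filter_upwards [h] with t ht
    refine ht.trans ?_
    simp [g, A]

section TangentSpaceOfSubset

variable {E : Type*} [NormedAddCommGroup E] [NormedSpace ℝ E]
  {M : Type*} [TopologicalSpace M] [ChartedSpace E M]
  {W : Type*} [NormedAddCommGroup W] [NormedSpace ℝ W]

theorem mvfderiv_eq_zero_of_mem_tangentSpaceOf {S : Set M} {x : M} {c : M → W}
    (hc : MDifferentiableAt 𝓘(ℝ, E) 𝓘(ℝ, W) c x) (h0 : ∀ᶠ y in 𝓝 x, y ∈ S → c y = 0)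
    {v : TangentSpace 𝓘(ℝ, E) x} (hv : v ∈ tangentSpaceOf 𝓘(ℝ, E) S x) :
    mvfderiv 𝓘(ℝ, E) c x v = 0 := by
  have hle : tangentSpaceOf 𝓘(ℝ, E) S x ≤ LinearMap.ker (mvfderiv 𝓘(ℝ, E) c x).toLinearMap := by
    rw [tangentSpaceOf, Submodule.span_le]
    rintro w ⟨γ, hγ, hγS, h⟩
    have hx : γ 0 = x := congrArg TotalSpace.proj h
    subst hx
    have hw : mfderiv 𝓘(ℝ, ℝ) 𝓘(ℝ, E) γ 0 (1 : ℝ) = w := by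
      simpa [tangentMap] using h
    have hγd : MDifferentiableAt 𝓘(ℝ, ℝ) 𝓘(ℝ, E) γ 0 := hγ.mdifferentiableAt (by simp)
    have h1 := mvfderiv_comp_mfderiv hc hγd (1 : ℝ)
    have h2 : (fun t => c (γ t)) =ᶠ[𝓝 0] fun _ => (0 : W) := by
      filter_upwards [hγd.continuousAt.eventually h0, hγS] with t ht1 ht2 using ht1 ht2
    rw [h2.mvfderiv_eq, mvfderiv_const, hw] at h1
    exact h1.symm
  exact hle hv

variable [IsManifold 𝓘(ℝ, E) ∞ M]

theorem tangentMap_eq_of_deriv {γ : ℝ → M} {x : M} (hγ : MDifferentiableAt 𝓘(ℝ, ℝ) 𝓘(ℝ, E) γ 0)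
    (hx : γ 0 = x) {v : TangentSpace 𝓘(ℝ, E) x}
    (hd : HasDerivAt (extChartAt 𝓘(ℝ, E) x ∘ γ) (v : E) 0) :
    tangentMap 𝓘(ℝ, ℝ) 𝓘(ℝ, E) γ (⟨0, (1 : ℝ)⟩ : TangentBundle 𝓘(ℝ, ℝ) ℝ) =
      (⟨x, v⟩ : TangentBundle 𝓘(ℝ, E) M) := by
  subst hx
  have h1 := mfderiv_comp_apply (I := 𝓘(ℝ, ℝ)) (0 : ℝ)
    (mdifferentiableAt_extChartAt (I := 𝓘(ℝ, E)) (mem_chart_source E (γ 0))) hγ (1 : ℝ)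
  rw [mfderiv_extChartAt_self, mfderiv_eq_fderiv] at h1
  have h2 : mfderiv 𝓘(ℝ, ℝ) 𝓘(ℝ, E) γ 0 (1 : ℝ) = v := by
    refine h1.symm.trans ?_
    exact (fderiv_apply_one_eq_deriv (f := extChartAt 𝓘(ℝ, E) (γ 0) ∘ γ)).trans hd.deriv
  simp only [tangentMap]
  exact congrArg _ h2

theorem mem_tangentSpaceOf [CompleteSpace E] [FiniteDimensional ℝ W] {S : Set M} {x : M}
    {f : M → W} (hf : ContMDiffAt 𝓘(ℝ, E) 𝓘(ℝ, W) ∞ f x)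
    (hs : Function.Surjective (mfderiv 𝓘(ℝ, E) 𝓘(ℝ, W) f x))
    (h0 : ∀ᶠ y in 𝓝 x, f y = f x → y ∈ S) {v : TangentSpace 𝓘(ℝ, E) x}
    (hv : mvfderiv 𝓘(ℝ, E) f x v = 0) : v ∈ tangentSpaceOf 𝓘(ℝ, E) S x := by
  have hfd : MDifferentiableAt 𝓘(ℝ, E) 𝓘(ℝ, W) f x := hf.mdifferentiableAt (by simp)
  have hfc : ContDiffAt ℝ ∞ (f ∘ (extChartAt 𝓘(ℝ, E) x).symm) (extChartAt 𝓘(ℝ, E) x x) := by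
    have h := contDiffAt_chart hf
    simpa only [extChartAt_model_space_eq_id, PartialEquiv.refl_coe, Function.id_comp] using h
  obtain ⟨c, hc, hc0, hcd, hcf⟩ := exists_curve_of_fderiv_eq_zero hfc
    (fun w => (hs w).imp fun u hu => (mvfderiv_eq_fderiv hfd u).symm.trans hu)
    ((mvfderiv_eq_fderiv hfd v).symm.trans hv)
  have hsymm : ContMDiffAt 𝓘(ℝ, E) 𝓘(ℝ, E) ∞ (extChartAt 𝓘(ℝ, E) x).symm (c 0) := by
    rw [hc0]
    exact (contMDiffOn_extChartAt_symm x).contMDiffAt (extChartAt_target_mem_nhds x)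
  have hγ : ContMDiffAt 𝓘(ℝ, ℝ) 𝓘(ℝ, E) ∞ ((extChartAt 𝓘(ℝ, E) x).symm ∘ c) 0 :=
    hsymm.comp _ hc.contMDiffAt
  have hγ0 : ((extChartAt 𝓘(ℝ, E) x).symm ∘ c) 0 = x := by
    simp only [Function.comp_apply, hc0, extChartAt_to_inv]
  refine Submodule.subset_span ⟨(extChartAt 𝓘(ℝ, E) x).symm ∘ c, hγ, ?_, ?_⟩
  · have h1 : Tendsto ((extChartAt 𝓘(ℝ, E) x).symm ∘ c) (𝓝 0) (𝓝 x) := by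
      have := hγ.continuousAt.tendsto
      rwa [hγ0] at this
    filter_upwards [h1.eventually h0, hcf] with t ht1 ht2
    refine ht1 (ht2.trans ?_)
    simp only [Function.comp_apply, extChartAt_to_inv]
  · refine tangentMap_eq_of_deriv (hγ.mdifferentiableAt (by simp)) hγ0 ?_
    refine HasDerivAt.congr_of_eventuallyEq hcd ?_
    have h1 : Tendsto c (𝓝 0) (𝓝 (extChartAt 𝓘(ℝ, E) x x)) := by
      have := hc.continuousAt.tendsto
      rwa [hc0] at this
    filter_upwards [h1.eventually (extChartAt_target_mem_nhds x)] with t ht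
    exact (extChartAt 𝓘(ℝ, E) x).right_inv ht

end TangentSpaceOfSubset

theorem contDiffAt_kernel_correction {E W : Type*} [NormedAddCommGroup E] [NormedSpace ℝ E]
    [NormedAddCommGroup W] [NormedSpace ℝ W] [CompleteSpace W] {P : E →L[ℝ] W} {R : W →L[ℝ] E}
    (hR : P ∘L R = ContinuousLinearMap.id ℝ W) (v : E) :
    ContDiffAt ℝ ∞ (fun Q : E →L[ℝ] W => v - R (Ring.inverse (Q ∘L R) (Q v))) P := by
  have h1 : ContDiffAt ℝ ∞ (Ring.inverse : (W →L[ℝ] W) → _) (P ∘L R) := by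
    rw [hR]
    exact contDiffAt_ringInverse ℝ (1 : (W →L[ℝ] W)ˣ)
  have h2 : ContDiffAt ℝ ∞ (fun Q : E →L[ℝ] W => Q ∘L R) P :=
    contDiffAt_id.clm_comp contDiffAt_const
  have h3 : ContDiffAt ℝ ∞ (fun Q : E →L[ℝ] W => Ring.inverse (Q ∘L R)) P :=
    ContDiffAt.comp (f := fun Q : E →L[ℝ] W => Q ∘L R) P h1 h2
  have h4 : ContDiffAt ℝ ∞ (fun Q : E →L[ℝ] W => Q v) P :=
    (ContinuousLinearMap.apply ℝ W v).contDiff.contDiffAt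
  exact contDiffAt_const.sub (R.contDiff.contDiffAt.comp P (h3.clm_apply h4))

theorem eventually_kernel_correction {E W : Type*} [NormedAddCommGroup E] [NormedSpace ℝ E]
    [NormedAddCommGroup W] [NormedSpace ℝ W] [CompleteSpace W] {P : E →L[ℝ] W} {R : W →L[ℝ] E}
    (hR : P ∘L R = ContinuousLinearMap.id ℝ W) (v : E) :
    ∀ᶠ Q : E →L[ℝ] W in 𝓝 P, Q (v - R (Ring.inverse (Q ∘L R) (Q v))) = 0 := by
  have h2 : Tendsto (fun Q : E →L[ℝ] W => Q ∘L R) (𝓝 P) (𝓝 (1 : W →L[ℝ] W)) := by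
    have h : Continuous fun Q : E →L[ℝ] W => Q ∘L R := continuous_id.clm_comp continuous_const
    have := h.tendsto P
    rwa [hR] at this
  filter_upwards [h2.eventually (Units.nhds (1 : (W →L[ℝ] W)ˣ))] with Q hQ
  have h := congrArg (fun l => l (Q v)) (Ring.mul_inverse_cancel (Q ∘L R) hQ)
  simp only [mul_apply_eq_comp, ContinuousLinearMap.comp_apply,
    one_apply_eq_self] at h
  rw [map_sub, h, sub_self]

section MeanCurvature

variable {E : Type*} [NormedAddCommGroup E] [NormedSpace ℝ E]
  {M : Type*} [TopologicalSpace M] [ChartedSpace E M] [IsManifold 𝓘(ℝ, E) ∞ M]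

/-- The derivative of a vector-valued function read in the chart at `x`. -/
theorem exists_coord_mvfderiv {W : Type*} [NormedAddCommGroup W] [NormedSpace ℝ W] {f : M → W}
    {x : M} (hf : ContMDiffAt 𝓘(ℝ, E) 𝓘(ℝ, W) ∞ f x) :
    ∃ P : M → E →L[ℝ] W, ContMDiffAt 𝓘(ℝ, E) 𝓘(ℝ, E →L[ℝ] W) ∞ P x ∧
      ∀ y w, P y w = mvfderiv 𝓘(ℝ, E) f y
        ((trivializationAt E (TangentSpace 𝓘(ℝ, E)) x).symmL ℝ y w) := by
  refine ⟨_, hf.mfderiv_const (m := ∞) (by simp), fun y w => ?_⟩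
  simp only [inTangentCoordinates, ContinuousLinearMap.inCoordinates,
    TangentBundle.continuousLinearMapAt_model_space]
  rfl

theorem exists_tangent_field [FiniteDimensional ℝ E] {p : ℕ} {S : Set M}
    (hS : IsSubmanifold 𝓘(ℝ, E) p S) {x : M} (hx : x ∈ S) {v : TangentSpace 𝓘(ℝ, E) x}
    (hv : v ∈ tangentSpaceOf 𝓘(ℝ, E) S x) :
    ∃ X : ∀ y : M, TangentSpace 𝓘(ℝ, E) y,
      ContMDiffAt 𝓘(ℝ, E) 𝓘(ℝ, E).tangent ∞ (fun y => (⟨y, X y⟩ : TangentBundle 𝓘(ℝ, E) M)) x ∧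
      (∀ᶠ y in 𝓝 x, y ∈ S → X y ∈ tangentSpaceOf 𝓘(ℝ, E) S y) ∧ X x = v := by
  obtain ⟨U, hU, hxU, f, hf, hfs, hfS⟩ := hS x hx
  have hfx : ∀ y ∈ U, ContMDiffAt 𝓘(ℝ, E) (𝓡 p) ∞ f y := fun y hy =>
    hf.contMDiffAt (hU.mem_nhds hy)
  have hv0 : mvfderiv 𝓘(ℝ, E) f x v = 0 :=
    mvfderiv_eq_zero_of_mem_tangentSpaceOf ((hfx x hxU).mdifferentiableAt (by simp))
      (by filter_upwards [hU.mem_nhds hxU] with y hy hyS using (hfS y hy).1 hyS) hv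
  obtain ⟨P, hP, hPe⟩ := exists_coord_mvfderiv (hfx x hxU)
  have hsymm : ∀ w : TangentSpace 𝓘(ℝ, E) x,
      (trivializationAt E (TangentSpace 𝓘(ℝ, E)) x).symmL ℝ x w = w := by
    intro w
    have h := (eventually_extend_eq x w).self_of_nhds
    rw [FiberBundle.extend_apply_self] at h
    exact h.symm
  have hPx : ∀ w : E, P x w = mvfderiv 𝓘(ℝ, E) f x w := fun w =>
    (hPe x w).trans (congrArg _ (hsymm w))
  have hPs : Function.Surjective (P x) := fun w =>
    (hfs x hxU w).imp fun u hu => (hPx u).trans hu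
  obtain ⟨R, hR⟩ := (P x).exists_rightInverse_of_surjective (LinearMap.range_eq_top.2 hPs)
  let v' : E := v
  let ξ : M → E := fun y => v' - R (Ring.inverse (P y ∘L R) (P y v'))
  have hξ : ContMDiffAt 𝓘(ℝ, E) 𝓘(ℝ, E) ∞ ξ x :=
    (contDiffAt_kernel_correction hR v').contMDiffAt.comp
      (g := fun Q : E →L[ℝ] EuclideanSpace ℝ (Fin p) => v' - R (Ring.inverse (Q ∘L R) (Q v'))) x hP
  have hPξ : ∀ᶠ y in 𝓝 x, P y (ξ y) = 0 :=
    hP.continuousAt.eventually (eventually_kernel_correction hR v')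
  have hξx : ξ x = v' := by
    have h : P x v' = 0 := (hPx v).trans hv0
    simp only [ξ, h, map_zero, sub_zero]
  refine ⟨fun y => (trivializationAt E (TangentSpace 𝓘(ℝ, E)) x).symmL ℝ y (ξ y), ?_, ?_, ?_⟩
  · rw [contMDiffAt_section]
    refine hξ.congr_of_eventuallyEq ?_
    filter_upwards [(trivializationAt E (TangentSpace 𝓘(ℝ, E)) x).open_baseSet.mem_nhds
      (FiberBundle.mem_baseSet_trivializationAt' x)] with y hy
    rw [Trivialization.symmL_apply _ hy, Trivialization.apply_mk_symm _ hy]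
  · filter_upwards [hPξ, hU.mem_nhds hxU] with y hy hyU hyS
    refine mem_tangentSpaceOf (hfx y hyU) (hfs y hyU) ?_ ((hPe y _).symm.trans hy)
    filter_upwards [hU.mem_nhds hyU] with q hq hqf
    exact (hfS q hq).2 (hqf.trans ((hfS y hyU).1 hyS))
  · exact (congrArg _ hξx).trans (hsymm v)

variable [FiniteDimensional ℝ E] [RiemannianBundle (fun x : M => TangentSpace 𝓘(ℝ, E) x)]

theorem isMeanCurvature_meanCurvature {p : ℕ} {S : Set M} (hS : IsSubmanifold 𝓘(ℝ, E) p S) {x : M}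
    (hx : x ∈ S) : IsMeanCurvature 𝓘(ℝ, E) S x (meanCurvature 𝓘(ℝ, E) S x) := by
  have hex : ∃ V, IsMeanCurvature 𝓘(ℝ, E) S x V := by
    set b := stdOrthonormalBasis ℝ (tangentSpaceOf 𝓘(ℝ, E) S x)
    choose X h1 h2 h3 using fun i => exists_tangent_field hS hx (b i).2
    refine ⟨_, X, h1, h2, ?_, rfl⟩
    simp only [h3]
    exact b.orthonormal.comp_linearIsometry (tangentSpaceOf 𝓘(ℝ, E) S x).subtypeₗᵢ
  rw [meanCurvature, dif_pos hex]
  exact hex.choose_spec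

theorem IsMeanCurvature.exists_orthonormal {S : Set M} {x : M} (hx : x ∈ S)
    {V : TangentSpace 𝓘(ℝ, E) x} (hV : IsMeanCurvature 𝓘(ℝ, E) S x V) :
    ∃ X : Fin (Module.finrank ℝ (tangentSpaceOf 𝓘(ℝ, E) S x)) → TangentSpace 𝓘(ℝ, E) x,
      Orthonormal ℝ X ∧ (∀ i, X i ∈ tangentSpaceOf 𝓘(ℝ, E) S x) ∧
      ∀ c : M → ℝ, ContMDiffAt 𝓘(ℝ, E) 𝓘(ℝ, ℝ) ∞ c x → (∀ᶠ y in 𝓝 x, y ∈ S → c y = 0) →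
        mvfderiv 𝓘(ℝ, E) c x V = ∑ i, hessFun c x (X i) (X i) := by
  obtain ⟨X, hX, hXS, hXo, rfl⟩ := hV
  have hXx : ∀ i, X i x ∈ tangentSpaceOf 𝓘(ℝ, E) S x := fun i => (hXS i).self_of_nhds hx
  refine ⟨fun i => X i x, hXo, hXx, fun c hc hc0 => ?_⟩
  have hcd := hc.mdifferentiableAt (n := ∞) (by simp)
  have hker : ∀ v ∈ tangentSpaceOf 𝓘(ℝ, E) S x, mvfderiv 𝓘(ℝ, E) c x v = 0 := fun v hv =>
    mvfderiv_eq_zero_of_mem_tangentSpaceOf hcd hc0 hv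
  rw [map_neg, map_sum, ← Finset.sum_neg_distrib]
  refine Finset.sum_congr rfl fun i _ => ?_
  have hproj : ∀ u : TangentSpace 𝓘(ℝ, E) x, mvfderiv 𝓘(ℝ, E) c x
      ((tangentSpaceOf 𝓘(ℝ, E) S x)ᗮ.starProjection u) = mvfderiv 𝓘(ℝ, E) c x u := by
    intro u
    rw [Submodule.starProjection_orthogonal_val, map_sub,
      hker _ (Submodule.starProjection_apply_mem _ _), sub_zero]
  have hdiff : DiffAlong (E := E) (M := M) id (X i) x :=
    (contMDiffAt_section _).1 (hX i) |>.mdifferentiableAt (by simp)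
  obtain ⟨h1, h2⟩ := mvfderiv_mvfderiv_field hdiff hc
  have hev : ∀ᶠ y in 𝓝 x, y ∈ S → mvfderiv 𝓘(ℝ, E) c y (X i y) = 0 := by
    filter_upwards [hXS i, eventually_mdifferentiableAt hc, eventually_eventually_nhds.2 hc0]
      with y hy1 hy2 hy3 hyS
    exact mvfderiv_eq_zero_of_mem_tangentSpaceOf hy2 hy3 (hy1 hyS)
  have h3 := mvfderiv_eq_zero_of_mem_tangentSpaceOf h1 hev (hXx i)
  rw [h2] at h3
  rw [hproj]
  linarith

end MeanCurvature

section LinearAlgebra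

variable {T : Type*} [NormedAddCommGroup T] [InnerProductSpace ℝ T]
  {T' : Type*} [NormedAddCommGroup T'] [InnerProductSpace ℝ T']

theorem sum_bilin_eq_of_expansion {ι κ : Type*} [Fintype ι] [Fintype κ] [DecidableEq κ]
    (Q : T →ₗ[ℝ] T →ₗ[ℝ] ℝ) (u : ι → T) (Y : κ → T) (r : ℝ)
    (hu : ∀ j, u j = ∑ k, ⟪Y k, u j⟫ • Y k)
    (hr : ∀ k l, ∑ j, ⟪Y k, u j⟫ * ⟪Y l, u j⟫ = if k = l then r else 0) :
    ∑ j, Q (u j) (u j) = r * ∑ k, Q (Y k) (Y k) := by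
  have h1 : ∀ j, Q (u j) (u j) = ∑ k, ∑ l, ⟪Y k, u j⟫ * ⟪Y l, u j⟫ * Q (Y k) (Y l) := by
    intro j
    conv_lhs => rw [hu j]
    simp only [map_sum, map_smul, LinearMap.sum_apply, LinearMap.smul_apply, smul_eq_mul,
      Finset.mul_sum]
    refine Finset.sum_comm.trans (Finset.sum_congr rfl fun k _ =>
      Finset.sum_congr rfl fun l _ => ?_)
    ring
  simp_rw [h1]
  rw [Finset.sum_comm]
  simp_rw [fun k => Finset.sum_comm (s := (Finset.univ : Finset ι)) (t := (Finset.univ : Finset κ))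
    (f := fun j l => ⟪Y k, u j⟫ * ⟪Y l, u j⟫ * Q (Y k) (Y l)), ← Finset.sum_mul, hr]
  simp [Finset.mul_sum]

theorem eq_sum_inner_of_mem_span {ι : Type*} [Fintype ι] {X : ι → T} (hX : Orthonormal ℝ X) {v : T}
    (hv : v ∈ Submodule.span ℝ (Set.range X)) : v = ∑ j, ⟪X j, v⟫ • X j := by
  classical
  induction hv using Submodule.span_induction with
  | mem w hw =>
    obtain ⟨k, rfl⟩ := hw
    simp [orthonormal_iff_ite.1 hX]
  | zero => simp
  | add a b _ _ ha hb =>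
    simp only [inner_add_right, add_smul, Finset.sum_add_distrib]
    rw [← ha, ← hb]
  | smul c a _ ha =>
    simp only [real_inner_smul_right, mul_smul, ← Finset.smul_sum]
    rw [← ha]

theorem inner_eq_sum_of_mem_span {ι : Type*} [Fintype ι] {X : ι → T} (hX : Orthonormal ℝ X)
    {v : T} (hv : v ∈ Submodule.span ℝ (Set.range X)) (w : T) :
    ∑ j, ⟪X j, v⟫ * ⟪X j, w⟫ = ⟪v, w⟫ := by
  conv_rhs => rw [eq_sum_inner_of_mem_span hX hv]
  simp only [sum_inner, real_inner_smul_left]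

theorem span_eq_of_orthonormal [FiniteDimensional ℝ T] {W : Submodule ℝ T}
    {X : Fin (Module.finrank ℝ W) → T} (hX : Orthonormal ℝ X) (hXW : ∀ i, X i ∈ W) :
    Submodule.span ℝ (Set.range X) = W := by
  refine Submodule.eq_of_le_of_finrank_eq (Submodule.span_le.2 ?_) ?_
  · rintro _ ⟨i, rfl⟩
    exact hXW i
  · rw [finrank_span_eq_card hX.linearIndependent, Fintype.card_fin]

variable [FiniteDimensional ℝ T]

omit [FiniteDimensional ℝ T] in
theorem sum_bilin_basis_eq {ι κ : Type*} [Fintype ι] [Fintype κ] (Q : T →ₗ[ℝ] T →ₗ[ℝ] ℝ)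
    (b : OrthonormalBasis ι ℝ T) (b' : OrthonormalBasis κ ℝ T) :
    ∑ i, Q (b i) (b i) = ∑ k, Q (b' k) (b' k) := by
  classical
  rw [sum_bilin_eq_of_expansion Q b b' 1 (fun j => (b'.sum_repr' (b j)).symm), one_mul]
  intro k l
  have h : ∀ j, ⟪b' k, b j⟫ * ⟪b' l, b j⟫ = ⟪b' k, b j⟫ * ⟪b j, b' l⟫ := fun j => by
    rw [real_inner_comm (b j) (b' l)]
  simp_rw [h]
  rw [b.sum_inner_mul_inner, orthonormal_iff_ite.1 b'.orthonormal]

theorem sum_bilin_add_orthogonal {ι : Type*} [Fintype ι] (Q : T →ₗ[ℝ] T →ₗ[ℝ] ℝ)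
    (b : OrthonormalBasis ι ℝ T) {W : Submodule ℝ T} {X : Fin (Module.finrank ℝ W) → T}
    (hX : Orthonormal ℝ X) (hXW : ∀ i, X i ∈ W) :
    ∑ i, Q (b i) (b i) = ∑ j, Q (X j) (X j)
      + ∑ a, Q (stdOrthonormalBasis ℝ Wᗮ a) (stdOrthonormalBasis ℝ Wᗮ a) := by
  classical
  set e := stdOrthonormalBasis ℝ Wᗮ
  let Y : Fin (Module.finrank ℝ W) ⊕ Fin (Module.finrank ℝ Wᗮ) → T :=
    Sum.elim X (fun a => (e a : T))
  have he : Orthonormal ℝ fun a => (e a : T) := e.orthonormal.comp_linearIsometry Wᗮ.subtypeₗᵢ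
  have hY : Orthonormal ℝ Y := by
    rw [orthonormal_iff_ite]
    rintro (i | i) (j | j)
    · simpa [Y] using orthonormal_iff_ite.1 hX i j
    · simpa [Y] using Submodule.inner_right_of_mem_orthogonal (hXW i) (e j).2
    · simpa [Y] using Submodule.inner_left_of_mem_orthogonal (hXW j) (e i).2
    · simpa [Y] using orthonormal_iff_ite.1 he i j
  have hspan : ⊤ ≤ Submodule.span ℝ (Set.range Y) := by
    refine (hY.linearIndependent.span_eq_top_of_card_eq_finrank' ?_).ge
    simp [W.finrank_add_finrank_orthogonal]
  rw [sum_bilin_basis_eq Q b (OrthonormalBasis.mk hY hspan)]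
  simp [Y, Fintype.sum_sum_type]

theorem exists_horizontal_lift {L : T →ₗ[ℝ] T'} (hL : Function.Surjective L) (z : T') :
    ∃ w ∈ (LinearMap.ker L)ᗮ, L w = z := by
  obtain ⟨u, rfl⟩ := hL z
  refine ⟨u - (LinearMap.ker L).starProjection u,
    Submodule.sub_starProjection_mem_orthogonal u, ?_⟩
  rw [map_sub, LinearMap.mem_ker.1 (Submodule.starProjection_apply_mem _ u), sub_zero]

theorem inner_map_of_horizontal {L : T →ₗ[ℝ] T'} {r : ℝ}
    (h : ∀ v ∈ (LinearMap.ker L)ᗮ, ∀ w ∈ (LinearMap.ker L)ᗮ, r * ⟪v, w⟫ = ⟪L v, L w⟫)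
    (z : T) {w : T} (hw : w ∈ (LinearMap.ker L)ᗮ) : ⟪L z, L w⟫ = r * ⟪z, w⟫ := by
  have h1 := h _ (Submodule.sub_starProjection_mem_orthogonal (K := LinearMap.ker L) z) w hw
  have h2 : (LinearMap.ker L).starProjection z ∈ LinearMap.ker L :=
    Submodule.starProjection_apply_mem _ z
  rw [map_sub, LinearMap.mem_ker.1 h2, sub_zero, inner_sub_left,
    Submodule.inner_right_of_mem_orthogonal h2 hw, sub_zero] at h1
  exact h1.symm

theorem sum_bilin_map_eq [FiniteDimensional ℝ T'] {L : T →ₗ[ℝ] T'} (hL : Function.Surjective L)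
    {r : ℝ}
    (h : ∀ v ∈ (LinearMap.ker L)ᗮ, ∀ w ∈ (LinearMap.ker L)ᗮ, r * ⟪v, w⟫ = ⟪L v, L w⟫)
    (Q : T' →ₗ[ℝ] T' →ₗ[ℝ] ℝ) {W : Submodule ℝ T} {W' : Submodule ℝ T'} (hW : W = W'.comap L)
    {X : Fin (Module.finrank ℝ W) → T} (hX : Orthonormal ℝ X) (hXW : ∀ i, X i ∈ W)
    {Y : Fin (Module.finrank ℝ W') → T'} (hY : Orthonormal ℝ Y) (hYW : ∀ i, Y i ∈ W') :
    ∑ j, Q (L (X j)) (L (X j)) = r * ∑ k, Q (Y k) (Y k) := by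
  choose w hw hwY using fun k => exists_horizontal_lift hL (Y k)
  refine sum_bilin_eq_of_expansion Q (fun j => L (X j)) Y r (fun j => ?_) fun k l => ?_
  · refine eq_sum_inner_of_mem_span hY ?_
    rw [span_eq_of_orthonormal hY hYW]
    have := hXW j
    rwa [hW] at this
  · have hwW : ∀ k, w k ∈ Submodule.span ℝ (Set.range X) := fun k => by
      rw [span_eq_of_orthonormal hX hXW, hW, Submodule.mem_comap, hwY]
      exact hYW k
    have h1 : ∀ k j, ⟪Y k, L (X j)⟫ = r * ⟪X j, w k⟫ := fun k j => by
      rw [real_inner_comm, ← hwY k, inner_map_of_horizontal h _ (hw k)]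
    have h2 : ∑ j, ⟪Y k, L (X j)⟫ * ⟪Y l, L (X j)⟫ =
        r * (r * ∑ j, ⟪X j, w k⟫ * ⟪X j, w l⟫) := by
      rw [Finset.mul_sum, Finset.mul_sum]
      refine Finset.sum_congr rfl fun j _ => ?_
      rw [h1, h1]
      ring
    rw [h2, inner_eq_sum_of_mem_span hX (hwW k), h _ (hw k) _ (hw l), hwY, hwY,
      orthonormal_iff_ite.1 hY]
    split_ifs <;> simp

section Spectrum

variable [FiniteDimensional ℝ T'] {L : T →ₗ[ℝ] T'} {n : ℕ} (hn : Module.finrank ℝ T' = n)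
  {e : Fin n → T} {r : Fin n → ℝ}
  (he : Orthonormal ℝ e) (hr : ∀ i, r i ≠ 0 ∧ ∀ v, ⟪L (e i), L v⟫ = r i * ⟪e i, v⟫)

include he hr in
omit [FiniteDimensional ℝ T] [FiniteDimensional ℝ T'] in
theorem eigenvalue_pos (i : Fin n) : 0 < r i := by
  have h := (hr i).2 (e i)
  rw [real_inner_self_eq_norm_sq (e i), he.1 i, one_pow, mul_one] at h
  exact lt_of_le_of_ne (h ▸ real_inner_self_nonneg) (hr i).1.symm

include hn he hr in
omit [FiniteDimensional ℝ T] in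
theorem map_eq_zero_of_inner_eigenvectors_eq_zero {v : T} (hv : ∀ i, ⟪e i, v⟫ = 0) : L v = 0 := by
  have ho : ∀ i j, i ≠ j → ⟪L (e i), L (e j)⟫ = 0 := fun i j hij => by
    rw [(hr i).2, he.2 hij, mul_zero]
  have hne : ∀ i, L (e i) ≠ 0 := fun i h => by
    have h1 := (hr i).2 (e i)
    rw [h, inner_zero_left, real_inner_self_eq_norm_sq, he.1 i, one_pow, mul_one] at h1
    exact (hr i).1 h1.symm
  have hli : LinearIndependent ℝ fun i => L (e i) :=
    linearIndependent_of_ne_zero_of_inner_eq_zero hne ho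
  have hspan := hli.span_eq_top_of_card_eq_finrank' (by simp [hn])
  have hmem : L v ∈ Submodule.span ℝ (Set.range fun i => L (e i)) := hspan ▸ Submodule.mem_top
  have hle : Submodule.span ℝ (Set.range fun i => L (e i)) ≤ (ℝ ∙ L v)ᗮ := by
    rw [Submodule.span_le]
    rintro _ ⟨i, rfl⟩
    rw [SetLike.mem_coe, Submodule.mem_orthogonal_singleton_iff_inner_left, (hr i).2, hv,
      mul_zero]
  exact inner_self_eq_zero.1 (Submodule.mem_orthogonal_singleton_iff_inner_left.1 (hle hmem))

omit [FiniteDimensional ℝ T] [FiniteDimensional ℝ T'] in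
theorem inner_sub_sum_eq_zero (he : Orthonormal ℝ e) (v : T) (i : Fin n) :
    ⟪e i, v - ∑ j, ⟪e j, v⟫ • e j⟫ = 0 := by
  simp [inner_sub_right, inner_sum, real_inner_smul_right, orthonormal_iff_ite.1 he]

include hn he hr in
omit [FiniteDimensional ℝ T] in
theorem inner_map_eq_sum (v w : T) :
    ⟪L v, L w⟫ = ∑ i, r i * (⟪e i, v⟫ * ⟪e i, w⟫) := by
  have h := map_eq_zero_of_inner_eigenvectors_eq_zero hn he hr (inner_sub_sum_eq_zero he v)
  rw [map_sub, sub_eq_zero, map_sum] at h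
  rw [h, sum_inner]
  refine Finset.sum_congr rfl fun i _ => ?_
  rw [map_smul, real_inner_smul_left, (hr i).2]
  ring

include hn he hr in
omit [FiniteDimensional ℝ T] in
theorem inner_map_self_le (i₀ : Fin n) (v : T) :
    ⟪L v, L v⟫ ≤ (r i₀ + ∑ i, |r i - r i₀|) * ⟪v, v⟫ := by
  have hb : ∑ i, ⟪e i, v⟫ ^ 2 ≤ ⟪v, v⟫ := by
    have := he.sum_inner_products_le v (s := Finset.univ)
    simpa [real_inner_self_eq_norm_sq] using this
  have hbi : ∀ i, ⟪e i, v⟫ ^ 2 ≤ ⟪v, v⟫ := fun i =>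
    (Finset.single_le_sum (f := fun i => ⟪e i, v⟫ ^ 2) (fun _ _ => sq_nonneg _)
      (Finset.mem_univ i)).trans hb
  rw [inner_map_eq_sum hn he hr]
  calc ∑ i, r i * (⟪e i, v⟫ * ⟪e i, v⟫)
      = r i₀ * ∑ i, ⟪e i, v⟫ ^ 2 + ∑ i, (r i - r i₀) * ⟪e i, v⟫ ^ 2 := by
        rw [Finset.mul_sum, ← Finset.sum_add_distrib]
        exact Finset.sum_congr rfl fun i _ => by ring
    _ ≤ r i₀ * ⟪v, v⟫ + ∑ i, |r i - r i₀| * ⟪v, v⟫ := by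
        refine add_le_add (mul_le_mul_of_nonneg_left hb (eigenvalue_pos he hr i₀).le)
          (Finset.sum_le_sum fun i _ => ?_)
        exact mul_le_mul (le_abs_self _) (hbi i) (sq_nonneg _) (abs_nonneg _)
    _ = _ := by rw [← Finset.sum_mul]; ring

include hn he hr in
theorem trace_adjoint_comp_self :
    LinearMap.trace ℝ T (LinearMap.adjoint L ∘ₗ L) = ∑ i, r i := by
  let b := stdOrthonormalBasis ℝ T
  rw [LinearMap.trace_eq_sum_inner _ b]
  simp only [LinearMap.comp_apply, LinearMap.adjoint_inner_right, inner_map_eq_sum hn he hr]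
  rw [Finset.sum_comm]
  refine Finset.sum_congr rfl fun i _ => ?_
  rw [← Finset.mul_sum]
  have h : ∑ k, ⟪e i, b k⟫ * ⟪e i, b k⟫ = 1 := by
    have h1 : ∀ k, ⟪e i, b k⟫ * ⟪e i, b k⟫ = ⟪e i, b k⟫ * ⟪b k, e i⟫ := fun k => by
      rw [real_inner_comm (b k) (e i)]
    simp_rw [h1]
    rw [b.sum_inner_mul_inner, real_inner_self_eq_norm_sq, he.1 i, one_pow]
  rw [h, mul_one]

include hn he hr in
omit [FiniteDimensional ℝ T] in
theorem inner_map_eq_of_eigenvalues_eq {s : ℝ} (hs : ∀ i, r i = s) {v : T}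
    (hv : v ∈ (LinearMap.ker L)ᗮ) (w : T) : s * ⟪v, w⟫ = ⟪L v, L w⟫ := by
  have hd : v - ∑ j, ⟪e j, v⟫ • e j ∈ LinearMap.ker L :=
    map_eq_zero_of_inner_eigenvectors_eq_zero hn he hr (inner_sub_sum_eq_zero he v)
  have heo : ∀ j, e j ∈ (LinearMap.ker L)ᗮ := fun j => by
    rw [Submodule.mem_orthogonal']
    intro u hu
    have h := (hr j).2 u
    rw [LinearMap.mem_ker.1 hu, inner_zero_right] at h
    exact (mul_eq_zero.1 h.symm).resolve_left (hr j).1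
  have hd' : v - ∑ j, ⟪e j, v⟫ • e j ∈ (LinearMap.ker L)ᗮ :=
    sub_mem hv (Submodule.sum_mem _ fun j _ => Submodule.smul_mem _ _ (heo j))
  have h0 := inner_self_eq_zero.1 (Submodule.inner_right_of_mem_orthogonal hd hd' (𝕜 := ℝ))
  rw [inner_map_eq_sum hn he hr]
  conv_lhs => rw [sub_eq_zero.1 h0]
  simp only [sum_inner, real_inner_smul_left, hs, Finset.mul_sum]

end Spectrum

end LinearAlgebra

section EigenvalueFunctions

variable {E : Type*} [NormedAddCommGroup E] [NormedSpace ℝ E]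
  {M : Type*} [TopologicalSpace M] [ChartedSpace E M]

theorem mvfderiv_eq_zero_of_isLocalMin {f : M → ℝ} {x : M} (h : ∀ᶠ y in 𝓝 x, f x ≤ f y)
    (hf : MDifferentiableAt 𝓘(ℝ, E) 𝓘(ℝ, ℝ) f x) (u : TangentSpace 𝓘(ℝ, E) x) :
    mvfderiv 𝓘(ℝ, E) f x u = 0 := by
  refine (mvfderiv_eq_fderiv hf u).trans ?_
  have h3 : Tendsto (extChartAt 𝓘(ℝ, E) x).symm (𝓝 (extChartAt 𝓘(ℝ, E) x x)) (𝓝 x) := by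
    have := continuousAt_extChartAt_symm (I := 𝓘(ℝ, E)) x
    rwa [ContinuousAt, extChartAt_to_inv] at this
  have hmin : IsLocalMin (f ∘ (extChartAt 𝓘(ℝ, E) x).symm) (extChartAt 𝓘(ℝ, E) x x) := by
    filter_upwards [h3.eventually h] with z hz
    simpa only [Function.comp_apply, extChartAt_to_inv] using hz
  rw [hmin.fderiv_eq_zero]
  rfl

theorem mvfderiv_of_hasFDerivAt_chart {f : M → ℝ} {x : M} {l : E →L[ℝ] ℝ}
    (h : HasFDerivAt (f ∘ (extChartAt 𝓘(ℝ, E) x).symm) l (extChartAt 𝓘(ℝ, E) x x)) :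
    MDifferentiableAt 𝓘(ℝ, E) 𝓘(ℝ, ℝ) f x ∧ ∀ u : E, mvfderiv 𝓘(ℝ, E) f x u = l u := by
  have hd := mdifferentiableAt_iff_chart.2 h.differentiableAt
  exact ⟨hd, fun u => (mvfderiv_eq_fderiv hd u).trans (by rw [h.fderiv])⟩

theorem hasFDerivAt_abs_of_eq_zero {g : E → ℝ} {z : E} (hg : HasFDerivAt g (0 : E →L[ℝ] ℝ) z)
    (h0 : g z = 0) : HasFDerivAt (fun y => |g y|) (0 : E →L[ℝ] ℝ) z := by
  rw [hasFDerivAt_iff_isLittleO] at hg ⊢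
  simp only [h0, zero_apply, sub_zero, abs_zero] at hg ⊢
  exact hg.norm_left

variable {n : ℕ} {μ : Fin n → M → ℝ} {x : M}

theorem fderiv_chart_eq {f g : M → ℝ} (hf : MDifferentiableAt 𝓘(ℝ, E) 𝓘(ℝ, ℝ) f x)
    (hg : MDifferentiableAt 𝓘(ℝ, E) 𝓘(ℝ, ℝ) g x)
    (h : mvfderiv 𝓘(ℝ, E) f x = mvfderiv 𝓘(ℝ, E) g x) :
    fderiv ℝ (f ∘ (extChartAt 𝓘(ℝ, E) x).symm) (extChartAt 𝓘(ℝ, E) x x) =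
      fderiv ℝ (g ∘ (extChartAt 𝓘(ℝ, E) x).symm) (extChartAt 𝓘(ℝ, E) x x) :=
  ContinuousLinearMap.ext fun u => (mvfderiv_eq_fderiv hf u).symm.trans
    ((congrArg (fun l => l u) h).trans (mvfderiv_eq_fderiv hg u))

theorem mvfderiv_spectral_bound (hμ : ∀ i, MDifferentiableAt 𝓘(ℝ, E) 𝓘(ℝ, ℝ) (μ i) x) (i₀ : Fin n)
    (hv : ∀ i, μ i x = μ i₀ x) (hd : ∀ i, mvfderiv 𝓘(ℝ, E) (μ i) x = mvfderiv 𝓘(ℝ, E) (μ i₀) x) :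
    MDifferentiableAt 𝓘(ℝ, E) 𝓘(ℝ, ℝ) (fun y => μ i₀ y + ∑ i, |μ i y - μ i₀ y|) x ∧
    ∀ u : TangentSpace 𝓘(ℝ, E) x,
      mvfderiv 𝓘(ℝ, E) (fun y => μ i₀ y + ∑ i, |μ i y - μ i₀ y|) x u =
        mvfderiv 𝓘(ℝ, E) (μ i₀) x u := by
  have hc := fun i => (mdifferentiableAt_iff_chart.1 (hμ i)).hasFDerivAt
  have h1 : ∀ i, HasFDerivAt (fun z => |(μ i ∘ (extChartAt 𝓘(ℝ, E) x).symm) z -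
      (μ i₀ ∘ (extChartAt 𝓘(ℝ, E) x).symm) z|) (0 : E →L[ℝ] ℝ) (extChartAt 𝓘(ℝ, E) x x) := by
    intro i
    refine hasFDerivAt_abs_of_eq_zero ?_ ?_
    · have h := (hc i).fun_sub (hc i₀)
      rwa [fderiv_chart_eq (hμ i) (hμ i₀) (hd i), sub_self] at h
    · simp only [Function.comp_apply, extChartAt_to_inv, hv i, sub_self]
  have h2 := (hc i₀).fun_add (HasFDerivAt.fun_sum fun i (_ : i ∈ Finset.univ) => h1 i)
  rw [Finset.sum_const_zero, add_zero] at h2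
  obtain ⟨h3, h4⟩ := mvfderiv_of_hasFDerivAt_chart
    (f := fun y => μ i₀ y + ∑ i, |μ i y - μ i₀ y|) h2
  exact ⟨h3, fun u => (h4 u).trans (mvfderiv_eq_fderiv (hμ i₀) u).symm⟩

theorem mvfderiv_sum_eigenvalues (hμ : ∀ i, MDifferentiableAt 𝓘(ℝ, E) 𝓘(ℝ, ℝ) (μ i) x)
    (i₀ : Fin n) (hd : ∀ i, mvfderiv 𝓘(ℝ, E) (μ i) x = mvfderiv 𝓘(ℝ, E) (μ i₀) x) :
    MDifferentiableAt 𝓘(ℝ, E) 𝓘(ℝ, ℝ) (fun y => ∑ i, μ i y) x ∧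
    ∀ u : TangentSpace 𝓘(ℝ, E) x,
      mvfderiv 𝓘(ℝ, E) (fun y => ∑ i, μ i y) x u = n * mvfderiv 𝓘(ℝ, E) (μ i₀) x u := by
  have hc := fun i => (mdifferentiableAt_iff_chart.1 (hμ i)).hasFDerivAt
  have h2 := HasFDerivAt.fun_sum fun i (_ : i ∈ Finset.univ) => hc i
  rw [Finset.sum_congr rfl fun i _ => fderiv_chart_eq (hμ i) (hμ i₀) (hd i), Finset.sum_const,
    Finset.card_univ, Fintype.card_fin, ← Nat.cast_smul_eq_nsmul ℝ] at h2
  obtain ⟨h3, h4⟩ := mvfderiv_of_hasFDerivAt_chart (f := fun y => ∑ i, μ i y) h2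
  exact ⟨h3, fun u => (h4 u).trans (congrArg ((n : ℝ) * ·) (mvfderiv_eq_fderiv (hμ i₀) u).symm)⟩

end EigenvalueFunctions

section FirstOrderConformality

variable {E : Type*} [NormedAddCommGroup E] [NormedSpace ℝ E] [FiniteDimensional ℝ E]
  {M : Type*} [TopologicalSpace M] [ChartedSpace E M] [IsManifold 𝓘(ℝ, E) ∞ M]
  [RiemannianBundle (fun x : M => TangentSpace 𝓘(ℝ, E) x)]
  {F : Type*} [NormedAddCommGroup F] [NormedSpace ℝ F] [FiniteDimensional ℝ F]
  {N : Type*} [TopologicalSpace N] [ChartedSpace F N] [IsManifold 𝓘(ℝ, F) ∞ N]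
  [RiemannianBundle (fun y : N => TangentSpace 𝓘(ℝ, F) y)]

omit [IsManifold 𝓘(ℝ, E) ∞ M] [FiniteDimensional ℝ F] [IsManifold 𝓘(ℝ, F) ∞ N]
  [RiemannianBundle (fun y : N => TangentSpace 𝓘(ℝ, F) y)] in
theorem inner_grad (f : M → ℝ) (x : M) (w : TangentSpace 𝓘(ℝ, E) x) :
    ⟪grad 𝓘(ℝ, E) f x, w⟫ = mvfderiv 𝓘(ℝ, E) f x w := by
  rw [grad]
  exact InnerProductSpace.toDual_symm_apply

omit [IsManifold 𝓘(ℝ, E) ∞ M] [IsManifold 𝓘(ℝ, F) ∞ N] in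
theorem IsNonzeroSpectrum.normDiff_eq {φ : M → N} {y : M} {μ : Fin (Module.finrank ℝ F) → ℝ}
    (h : IsNonzeroSpectrum 𝓘(ℝ, E) 𝓘(ℝ, F) φ y μ) :
    normDiff 𝓘(ℝ, E) 𝓘(ℝ, F) φ y = √(∑ i, μ i) := by
  obtain ⟨e, he, hr⟩ := h
  exact congrArg Real.sqrt (trace_adjoint_comp_self
    (L := (mfderiv 𝓘(ℝ, E) 𝓘(ℝ, F) φ y).toLinearMap) rfl he hr)

omit [FiniteDimensional ℝ E] [IsManifold 𝓘(ℝ, E) ∞ M] [IsManifold 𝓘(ℝ, F) ∞ N] in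
theorem IsNonzeroSpectrum.inner_le {φ : M → N} {y : M} {μ : Fin (Module.finrank ℝ F) → ℝ}
    (h : IsNonzeroSpectrum 𝓘(ℝ, E) 𝓘(ℝ, F) φ y μ) (i₀ : Fin (Module.finrank ℝ F))
    (v : TangentSpace 𝓘(ℝ, E) y) :
    ⟪mfderiv 𝓘(ℝ, E) 𝓘(ℝ, F) φ y v, mfderiv 𝓘(ℝ, E) 𝓘(ℝ, F) φ y v⟫ ≤
      (μ i₀ + ∑ i, |μ i - μ i₀|) * ⟪v, v⟫ := by
  obtain ⟨e, he, hr⟩ := h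
  exact inner_map_self_le (L := (mfderiv 𝓘(ℝ, E) 𝓘(ℝ, F) φ y).toLinearMap) rfl he hr i₀ v

end FirstOrderConformality

section FirstOrderConformality

variable {E : Type*} [NormedAddCommGroup E] [NormedSpace ℝ E] [FiniteDimensional ℝ E]
  {M : Type*} [TopologicalSpace M] [ChartedSpace E M] [IsManifold 𝓘(ℝ, E) ∞ M]
  [RiemannianBundle (fun x : M => TangentSpace 𝓘(ℝ, E) x)]
  {F : Type*} [NormedAddCommGroup F] [NormedSpace ℝ F] [FiniteDimensional ℝ F]
  {N : Type*} [TopologicalSpace N] [ChartedSpace F N] [IsManifold 𝓘(ℝ, F) ∞ N]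
  [RiemannianBundle (fun y : N => TangentSpace 𝓘(ℝ, F) y)]

omit [IsManifold 𝓘(ℝ, E) ∞ M] [IsManifold 𝓘(ℝ, F) ∞ N] in
/-- A map that is weakly horizontally conformal to first order has, near the point, its first
fundamental form bounded by a function `ρ` that is differentiable at the point, with equality there
on horizontal vectors; the derivative of `ρ` determines that of `ln ‖dφ‖`. -/
theorem IsWHCFirstOrder.exists_bound {φ : M → N} {x : M}
    (h : IsWHCFirstOrder 𝓘(ℝ, E) 𝓘(ℝ, F) φ x) (hF : 0 < Module.finrank ℝ F) :
    ∃ ρ : M → ℝ, MDifferentiableAt 𝓘(ℝ, E) 𝓘(ℝ, ℝ) ρ x ∧ 0 < ρ x ∧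
      (∀ v ∈ (LinearMap.ker (mfderiv 𝓘(ℝ, E) 𝓘(ℝ, F) φ x).toLinearMap)ᗮ,
        ∀ w : TangentSpace 𝓘(ℝ, E) x, ρ x * ⟪v, w⟫ =
          ⟪mfderiv 𝓘(ℝ, E) 𝓘(ℝ, F) φ x v, mfderiv 𝓘(ℝ, E) 𝓘(ℝ, F) φ x w⟫) ∧
      (∀ᶠ y in 𝓝 x, ∀ v : TangentSpace 𝓘(ℝ, E) y,
        ⟪mfderiv 𝓘(ℝ, E) 𝓘(ℝ, F) φ y v, mfderiv 𝓘(ℝ, E) 𝓘(ℝ, F) φ y v⟫ ≤ ρ y * ⟪v, v⟫) ∧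
      0 < normDiff 𝓘(ℝ, E) 𝓘(ℝ, F) φ x ∧
      ∀ u : TangentSpace 𝓘(ℝ, E) x,
        2 * ρ x * mvfderiv 𝓘(ℝ, E) (fun y => Real.log (normDiff 𝓘(ℝ, E) 𝓘(ℝ, F) φ y)) x u =
          mvfderiv 𝓘(ℝ, E) ρ x u := by
  obtain ⟨μ, hμ, hμd, hμe⟩ := h
  let i₀ : Fin (Module.finrank ℝ F) := ⟨0, hF⟩
  have hd : ∀ i, mvfderiv 𝓘(ℝ, E) (μ i) x = mvfderiv 𝓘(ℝ, E) (μ i₀) x := fun i => by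
    ext w
    rw [← inner_grad, ← inner_grad, (hμe i i₀).2]
  have hv : ∀ i, μ i x = μ i₀ x := fun i => (hμe i i₀).1
  obtain ⟨hρ, hρd⟩ := mvfderiv_spectral_bound hμd i₀ hv hd
  obtain ⟨hS, hSd⟩ := mvfderiv_sum_eigenvalues hμd i₀ hd
  have hρx : μ i₀ x + ∑ i, |μ i x - μ i₀ x| = μ i₀ x := by simp [hv]
  have hSx : ∑ i, μ i x = Module.finrank ℝ F * μ i₀ x := by simp [hv]
  have hpos : ∀ᶠ y in 𝓝 x, ∀ i, 0 < μ i y := by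
    filter_upwards [hμ] with y ⟨e, he, hr⟩ i
    exact eigenvalue_pos (L := (mfderiv 𝓘(ℝ, E) 𝓘(ℝ, F) φ y).toLinearMap) he hr i
  have hFR : (0 : ℝ) < Module.finrank ℝ F := by exact_mod_cast hF
  have hμx : 0 < μ i₀ x := hpos.self_of_nhds i₀
  have hSpos : 0 < ∑ i, μ i x := by rw [hSx]; positivity
  refine ⟨fun y => μ i₀ y + ∑ i, |μ i y - μ i₀ y|, hρ, ?_, ?_, ?_, ?_, ?_⟩
  · simpa only [hρx] using hμx
  · intro v hvk w
    obtain ⟨e, he, hr⟩ := hμ.self_of_nhds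
    simp only [hρx]
    exact inner_map_eq_of_eigenvalues_eq (L := (mfderiv 𝓘(ℝ, E) 𝓘(ℝ, F) φ x).toLinearMap)
      rfl he hr hv hvk w
  · filter_upwards [hμ] with y hy v using hy.inner_le i₀ v
  · rw [hμ.self_of_nhds.normDiff_eq]
    exact Real.sqrt_pos.2 hSpos
  · intro u
    have hlog : (fun y => Real.log (normDiff 𝓘(ℝ, E) 𝓘(ℝ, F) φ y)) =ᶠ[𝓝 x]
        fun y => Real.log (∑ i, μ i y) * 2⁻¹ := by
      filter_upwards [hμ, hpos] with y hy hyp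
      rw [hy.normDiff_eq, Real.log_sqrt (Finset.sum_nonneg fun i _ => (hyp i).le), div_eq_mul_inv]
    have hc := (mdifferentiableAt_iff_chart.1 hS).hasFDerivAt
    have h1 := (hc.log (by
      simpa only [Function.comp_apply, extChartAt_to_inv] using hSpos.ne')).mul_const (2⁻¹ : ℝ)
    obtain ⟨-, h2⟩ := mvfderiv_of_hasFDerivAt_chart
      (f := fun y => Real.log (∑ i, μ i y) * 2⁻¹) h1
    have h3 : ∀ (l : E →L[ℝ] ℝ) (a : ℝ) (w : E),
        ((2⁻¹ : ℝ) • (a⁻¹ • l)) w = 2⁻¹ * (a⁻¹ * l w) := fun l a w => by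
      simp only [smul_apply, smul_eq_mul]
    have h4 := (h2 u).trans (h3 _ _ u)
    rw [Function.comp_apply, extChartAt_to_inv, hSx] at h4
    have h5 := (mvfderiv_eq_fderiv hS u).symm.trans (hSd u)
    rw [hlog.mvfderiv_eq, hρd, h4.trans (congrArg _ (congrArg _ h5))]
    simp only [hρx]
    field_simp

variable [IsContMDiffRiemannianBundle 𝓘(ℝ, E) ∞ E (fun x : M => TangentSpace 𝓘(ℝ, E) x)]
  [IsContMDiffRiemannianBundle 𝓘(ℝ, F) ∞ F (fun y : N => TangentSpace 𝓘(ℝ, F) y)]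

theorem hessian_add_right {φ : M → N} {x : M} (hφ : ContMDiffAt 𝓘(ℝ, E) 𝓘(ℝ, F) ∞ φ x)
    (u v w : TangentSpace 𝓘(ℝ, E) x) :
    hessian 𝓘(ℝ, E) 𝓘(ℝ, F) φ x u (v + w) =
      hessian 𝓘(ℝ, E) 𝓘(ℝ, F) φ x u v + hessian 𝓘(ℝ, E) 𝓘(ℝ, F) φ x u w := by
  have h : coordDeriv φ (fun y => mfderiv 𝓘(ℝ, E) 𝓘(ℝ, F) φ y (FiberBundle.extend E (v + w) y))
      x u = coordDeriv φ (fun y => mfderiv 𝓘(ℝ, E) 𝓘(ℝ, F) φ y (FiberBundle.extend E v y)) x u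
        + coordDeriv φ (fun y => mfderiv 𝓘(ℝ, E) 𝓘(ℝ, F) φ y (FiberBundle.extend E w y)) x u := by
    rw [coordDeriv_mfderiv_extend hφ, coordDeriv_mfderiv_extend hφ, coordDeriv_mfderiv_extend hφ]
    exact map_add (fderiv ℝ (fderiv ℝ (extChartAt 𝓘(ℝ, F) (φ x) ∘ φ ∘ (extChartAt 𝓘(ℝ, E) x).symm))
        (extChartAt 𝓘(ℝ, E) x x) u : E →L[ℝ] F) v w
  simp only [hessian_eq, pullbackConnection_eq, h, FiberBundle.extend_apply_self, map_add,
    christoffel_add_right]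
  abel

theorem inner_hessian_self {φ : M → N} {x : M} (hφ : ContMDiffAt 𝓘(ℝ, E) 𝓘(ℝ, F) ∞ φ x)
    {ρ : M → ℝ} (hρ : MDifferentiableAt 𝓘(ℝ, E) 𝓘(ℝ, ℝ) ρ x)
    (hconf : ∀ v ∈ (LinearMap.ker (mfderiv 𝓘(ℝ, E) 𝓘(ℝ, F) φ x).toLinearMap)ᗮ,
      ∀ w : TangentSpace 𝓘(ℝ, E) x, ρ x * ⟪v, w⟫ =
        ⟪mfderiv 𝓘(ℝ, E) 𝓘(ℝ, F) φ x v, mfderiv 𝓘(ℝ, E) 𝓘(ℝ, F) φ x w⟫)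
    (hle : ∀ᶠ y in 𝓝 x, ∀ v : TangentSpace 𝓘(ℝ, E) y,
      ⟪mfderiv 𝓘(ℝ, E) 𝓘(ℝ, F) φ y v, mfderiv 𝓘(ℝ, E) 𝓘(ℝ, F) φ y v⟫ ≤ ρ y * ⟪v, v⟫)
    {v : TangentSpace 𝓘(ℝ, E) x}
    (hv : v ∈ (LinearMap.ker (mfderiv 𝓘(ℝ, E) 𝓘(ℝ, F) φ x).toLinearMap)ᗮ)
    (u : TangentSpace 𝓘(ℝ, E) x) :
    2 * ⟪hessian 𝓘(ℝ, E) 𝓘(ℝ, F) φ x u v, mfderiv 𝓘(ℝ, E) 𝓘(ℝ, F) φ x v⟫ =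
      mvfderiv 𝓘(ℝ, E) ρ x u * ⟪v, v⟫ := by
  have hg := mdifferentiableAt_inner_extend x v v
  have hρg : MDifferentiableAt 𝓘(ℝ, E) 𝓘(ℝ, ℝ) (fun y => ρ y *
      ⟪(FiberBundle.extend E v y : TangentSpace 𝓘(ℝ, E) y), FiberBundle.extend E v y⟫) x :=
    hρ.mul hg
  have hs := diffAlong_mfderiv_extend hφ v
  have hi := (mvfderiv_inner_along (hφ.mdifferentiableAt (by simp)) hs hs).1
  have hmin := mvfderiv_eq_zero_of_isLocalMin
    (f := fun y => ρ y * ⟪(FiberBundle.extend E v y : TangentSpace 𝓘(ℝ, E) y),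
        FiberBundle.extend E v y⟫
      - ⟪mfderiv 𝓘(ℝ, E) 𝓘(ℝ, F) φ y (FiberBundle.extend E v y),
        mfderiv 𝓘(ℝ, E) 𝓘(ℝ, F) φ y (FiberBundle.extend E v y)⟫) (x := x) (by
      filter_upwards [hle] with y hy
      rw [FiberBundle.extend_apply_self, hconf v hv v, sub_self]
      exact sub_nonneg.2 (hy _)) (hρg.sub hi) u
  rw [mvfderiv_fun_sub hρg hi, mvfderiv_fun_mul hρ hg] at hmin
  simp only [sub_apply, add_apply, smul_apply, smul_eq_mul, FiberBundle.extend_apply_self] at hmin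
  rw [mvfderiv_inner_mfderiv_extend hφ u v v] at hmin
  have h1 := metricDeriv_eq x v v u
  have h2 := hconf v hv (christoffel 𝓘(ℝ, E) x u v)
  rw [metricDeriv] at h1
  rw [h1, real_inner_comm v (christoffel 𝓘(ℝ, E) x u v),
    real_inner_comm (mfderiv 𝓘(ℝ, E) 𝓘(ℝ, F) φ x v) (hessian 𝓘(ℝ, E) 𝓘(ℝ, F) φ x u v),
    real_inner_comm (mfderiv 𝓘(ℝ, E) 𝓘(ℝ, F) φ x v)] at hmin
  rw [real_inner_comm (mfderiv 𝓘(ℝ, E) 𝓘(ℝ, F) φ x v)]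
  linarith

theorem inner_hessian_self_left {φ : M → N} {x : M} (hφ : ContMDiffAt 𝓘(ℝ, E) 𝓘(ℝ, F) ∞ φ x)
    {ρ : M → ℝ} (hρ : MDifferentiableAt 𝓘(ℝ, E) 𝓘(ℝ, ℝ) ρ x)
    (hconf : ∀ v ∈ (LinearMap.ker (mfderiv 𝓘(ℝ, E) 𝓘(ℝ, F) φ x).toLinearMap)ᗮ,
      ∀ w : TangentSpace 𝓘(ℝ, E) x, ρ x * ⟪v, w⟫ =
        ⟪mfderiv 𝓘(ℝ, E) 𝓘(ℝ, F) φ x v, mfderiv 𝓘(ℝ, E) 𝓘(ℝ, F) φ x w⟫)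
    (hle : ∀ᶠ y in 𝓝 x, ∀ v : TangentSpace 𝓘(ℝ, E) y,
      ⟪mfderiv 𝓘(ℝ, E) 𝓘(ℝ, F) φ y v, mfderiv 𝓘(ℝ, E) 𝓘(ℝ, F) φ y v⟫ ≤ ρ y * ⟪v, v⟫)
    {v w : TangentSpace 𝓘(ℝ, E) x}
    (hv : v ∈ (LinearMap.ker (mfderiv 𝓘(ℝ, E) 𝓘(ℝ, F) φ x).toLinearMap)ᗮ)
    (hw : w ∈ (LinearMap.ker (mfderiv 𝓘(ℝ, E) 𝓘(ℝ, F) φ x).toLinearMap)ᗮ) :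
    ⟪hessian 𝓘(ℝ, E) 𝓘(ℝ, F) φ x v v, mfderiv 𝓘(ℝ, E) 𝓘(ℝ, F) φ x w⟫ =
      mvfderiv 𝓘(ℝ, E) ρ x v * ⟪v, w⟫ - 2⁻¹ * (mvfderiv 𝓘(ℝ, E) ρ x w * ⟪v, v⟫) := by
  have h1 := inner_hessian_self hφ hρ hconf hle (add_mem hv hw) v
  have h2 := inner_hessian_self hφ hρ hconf hle hv v
  have h3 := inner_hessian_self hφ hρ hconf hle hw v
  have h4 := inner_hessian_self hφ hρ hconf hle hv w
  rw [hessian_comm hφ w v] at h4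
  rw [hessian_add_right hφ, map_add, inner_add_left, inner_add_right, inner_add_right,
    inner_add_left, inner_add_right, inner_add_right, real_inner_comm v w] at h1
  linarith

end FirstOrderConformality

section Preimage

variable {E : Type*} [NormedAddCommGroup E] [NormedSpace ℝ E]
  {M : Type*} [TopologicalSpace M] [ChartedSpace E M]
  {F : Type*} [NormedAddCommGroup F] [NormedSpace ℝ F]
  {N : Type*} [TopologicalSpace N] [ChartedSpace F N]
  {W : Type*} [NormedAddCommGroup W] [NormedSpace ℝ W]

theorem surjective_mfderiv_comp {φ : M → N} {f : N → W} {x : M}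
    (hf : MDifferentiableAt 𝓘(ℝ, F) 𝓘(ℝ, W) f (φ x)) (hφ : MDifferentiableAt 𝓘(ℝ, E) 𝓘(ℝ, F) φ x)
    (hfs : Function.Surjective (mfderiv 𝓘(ℝ, F) 𝓘(ℝ, W) f (φ x)))
    (hφs : Function.Surjective (mfderiv 𝓘(ℝ, E) 𝓘(ℝ, F) φ x)) :
    Function.Surjective (mfderiv 𝓘(ℝ, E) 𝓘(ℝ, W) (f ∘ φ) x) := by
  rw [mfderiv_comp x hf hφ]
  exact hfs.comp hφs

theorem IsSubmanifold.preimage {p : ℕ} {B : Set N} (hB : IsSubmanifold 𝓘(ℝ, F) p B) {φ : M → N}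
    (hφ : IsSubmersive 𝓘(ℝ, E) 𝓘(ℝ, F) φ) : IsSubmanifold 𝓘(ℝ, E) p (φ ⁻¹' B) := by
  intro x hx
  obtain ⟨U, hU, hxU, f, hf, hfs, hfB⟩ := hB (φ x) hx
  refine ⟨φ ⁻¹' U, hU.preimage hφ.1.continuous, hxU, f ∘ φ,
    hf.comp hφ.1.contMDiffOn fun _ hy => hy, fun y hy => ?_, fun y hy => hfB (φ y) hy⟩
  exact surjective_mfderiv_comp
    ((hf.contMDiffAt (hU.mem_nhds hy)).mdifferentiableAt (by simp))
    ((hφ.1 y).mdifferentiableAt (by simp)) (hfs _ hy) (hφ.2 y)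

variable [IsManifold 𝓘(ℝ, E) ∞ M] [CompleteSpace E]

theorem mem_tangentSpaceOf_iff [FiniteDimensional ℝ W] {S : Set M} {x : M} {f : M → W}
    (hf : ContMDiffAt 𝓘(ℝ, E) 𝓘(ℝ, W) ∞ f x)
    (hs : Function.Surjective (mfderiv 𝓘(ℝ, E) 𝓘(ℝ, W) f x)) (hx : x ∈ S)
    (hS : ∀ᶠ y in 𝓝 x, y ∈ S ↔ f y = 0) (v : TangentSpace 𝓘(ℝ, E) x) :
    v ∈ tangentSpaceOf 𝓘(ℝ, E) S x ↔ mvfderiv 𝓘(ℝ, E) f x v = 0 := by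
  have hx0 : f x = 0 := hS.self_of_nhds.1 hx
  refine ⟨mvfderiv_eq_zero_of_mem_tangentSpaceOf (hf.mdifferentiableAt (by simp))
    (hS.mono fun y hy => hy.1), mem_tangentSpaceOf hf hs (hS.mono fun y hy h => ?_)⟩
  exact hy.2 (h.trans hx0)

theorem tangentSpaceOf_preimage {p : ℕ} [CompleteSpace F] [IsManifold 𝓘(ℝ, F) ∞ N] {B : Set N}
    (hB : IsSubmanifold 𝓘(ℝ, F) p B)
    {φ : M → N} (hφ : IsSubmersive 𝓘(ℝ, E) 𝓘(ℝ, F) φ) {x : M} (hx : φ x ∈ B) :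
    tangentSpaceOf 𝓘(ℝ, E) (φ ⁻¹' B) x =
      (tangentSpaceOf 𝓘(ℝ, F) B (φ x)).comap (mfderiv 𝓘(ℝ, E) 𝓘(ℝ, F) φ x).toLinearMap := by
  obtain ⟨U, hU, hxU, f, hf, hfs, hfB⟩ := hB (φ x) hx
  have hfx := hf.contMDiffAt (hU.mem_nhds hxU)
  have hfd := hfx.mdifferentiableAt (by simp)
  have hφd := (hφ.1 x).mdifferentiableAt (n := ∞) (by simp)
  have hev : ∀ᶠ y in 𝓝 (φ x), y ∈ B ↔ f y = 0 := by
    filter_upwards [hU.mem_nhds hxU] with y hy using hfB y hy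
  ext v
  refine (mem_tangentSpaceOf_iff (hfx.comp x (hφ.1 x))
    (surjective_mfderiv_comp hfd hφd (hfs _ hxU) (hφ.2 x)) hx
    (hφd.continuousAt.eventually hev) v).trans ?_
  rw [Submodule.mem_comap]
  refine Iff.trans ?_ (mem_tangentSpaceOf_iff hfx (hfs _ hxU) hx hev _).symm
  rw [show mvfderiv 𝓘(ℝ, E) (f ∘ φ) x v = _ from mvfderiv_comp_mfderiv hfd hφd v]
  rfl

variable [FiniteDimensional ℝ E] [RiemannianBundle (fun x : M => TangentSpace 𝓘(ℝ, E) x)]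

theorem IsSubmanifold.finrank_orthogonal_tangentSpaceOf {p : ℕ} {S : Set M}
    (hS : IsSubmanifold 𝓘(ℝ, E) p S) {x : M} (hx : x ∈ S) :
    Module.finrank ℝ (tangentSpaceOf 𝓘(ℝ, E) S x)ᗮ = p := by
  obtain ⟨U, hU, hxU, f, hf, hfs, hfS⟩ := hS x hx
  have hfx := hf.contMDiffAt (hU.mem_nhds hxU)
  have hev : ∀ᶠ y in 𝓝 x, y ∈ S ↔ f y = 0 := by
    filter_upwards [hU.mem_nhds hxU] with y hy using hfS y hy
  let l : TangentSpace 𝓘(ℝ, E) x →ₗ[ℝ] EuclideanSpace ℝ (Fin p) :=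
    (mvfderiv 𝓘(ℝ, E) f x).toLinearMap
  have hl : Function.Surjective l := hfs x hxU
  have hker : tangentSpaceOf 𝓘(ℝ, E) S x = LinearMap.ker l := by
    ext v
    exact mem_tangentSpaceOf_iff hfx (hfs x hxU) hx hev v
  have h1 := l.finrank_range_add_finrank_ker
  have h2 := (LinearMap.ker l).finrank_add_finrank_orthogonal
  rw [LinearMap.range_eq_top.2 hl, finrank_top, finrank_euclideanSpace_fin] at h1
  rw [hker]
  omega

omit [FiniteDimensional ℝ E] in
theorem IsSubmanifold.exists_normal_function {p : ℕ} {S : Set M}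
    (hS : IsSubmanifold 𝓘(ℝ, E) p S) {x : M} (hx : x ∈ S) {Z : TangentSpace 𝓘(ℝ, E) x}
    (hZ : Z ∈ (tangentSpaceOf 𝓘(ℝ, E) S x)ᗮ) :
    ∃ c : M → ℝ, ContMDiffAt 𝓘(ℝ, E) 𝓘(ℝ, ℝ) ∞ c x ∧ (∀ᶠ y in 𝓝 x, y ∈ S → c y = 0) ∧
      ∀ v : TangentSpace 𝓘(ℝ, E) x, mvfderiv 𝓘(ℝ, E) c x v = ⟪v, Z⟫ := by
  obtain ⟨U, hU, hxU, f, hf, hfs, hfS⟩ := hS x hx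
  have hfx := hf.contMDiffAt (hU.mem_nhds hxU)
  have hev : ∀ᶠ y in 𝓝 x, y ∈ S ↔ f y = 0 := by
    filter_upwards [hU.mem_nhds hxU] with y hy using hfS y hy
  let l : TangentSpace 𝓘(ℝ, E) x →ₗ[ℝ] EuclideanSpace ℝ (Fin p) :=
    (mvfderiv 𝓘(ℝ, E) f x).toLinearMap
  have hl : Function.Surjective l := hfs x hxU
  obtain ⟨R, hR⟩ := l.exists_rightInverse_of_surjective (LinearMap.range_eq_top.2 hl)
  let a : EuclideanSpace ℝ (Fin p) →L[ℝ] ℝ :=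
    LinearMap.toContinuousLinearMap ((innerₛₗ ℝ Z) ∘ₗ R)
  have hal : ∀ v, a (l v) = ⟪v, Z⟫ := fun v => by
    have h1 : l (v - R (l v)) = 0 := by
      rw [map_sub, sub_eq_zero]
      exact (congrArg (fun k => k (l v)) hR).symm
    have h2 := hZ _ ((mem_tangentSpaceOf_iff hfx (hfs x hxU) hx hev _).2 h1)
    rw [inner_sub_left, sub_eq_zero] at h2
    rw [h2, real_inner_comm]
    rfl
  refine ⟨fun y => a (f y), a.contDiff.contMDiff.contMDiffAt.comp x hfx, ?_, fun v => ?_⟩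
  · filter_upwards [hev] with y hy hyS
    rw [hy.1 hyS, map_zero]
  · rw [← hal]
    have hfd := hfx.mdifferentiableAt (n := ∞) (by simp)
    have h := mvfderiv_comp_mfderiv (c := a) (φ := f)
      (a.contDiff.contMDiff.contMDiffAt.mdifferentiableAt (n := ∞) (by simp)) hfd v
    have ha : mfderiv 𝓘(ℝ, EuclideanSpace ℝ (Fin p)) 𝓘(ℝ, ℝ) a (f x) = a :=
      mfderiv_eq_fderiv.trans a.fderiv
    exact h.trans (congrArg (fun k : EuclideanSpace ℝ (Fin p) →L[ℝ] ℝ => k (l v)) ha)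

end Preimage

section FundamentalEquation

variable {E : Type*} [NormedAddCommGroup E] [NormedSpace ℝ E] [FiniteDimensional ℝ E]
  {M : Type*} [TopologicalSpace M] [ChartedSpace E M] [IsManifold 𝓘(ℝ, E) ∞ M]
  [RiemannianBundle (fun x : M => TangentSpace 𝓘(ℝ, E) x)]
  {F : Type*} [NormedAddCommGroup F] [NormedSpace ℝ F] [FiniteDimensional ℝ F]
  {N : Type*} [TopologicalSpace N] [ChartedSpace F N] [IsManifold 𝓘(ℝ, F) ∞ N]
  [RiemannianBundle (fun y : N => TangentSpace 𝓘(ℝ, F) y)]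

omit [IsManifold 𝓘(ℝ, E) ∞ M] [IsManifold 𝓘(ℝ, F) ∞ N] in
theorem IsWHCFirstOrder.exists_isConformalityFactor {φ : M → N} {x : M}
    (h : IsWHCFirstOrder 𝓘(ℝ, E) 𝓘(ℝ, F) φ x) :
    ∃ l : ℝ, 0 < l ∧ IsConformalityFactor 𝓘(ℝ, E) 𝓘(ℝ, F) φ x l := by
  rcases Nat.eq_zero_or_pos (Module.finrank ℝ F) with hF | hF
  · have hsub : Subsingleton (TangentSpace 𝓘(ℝ, F) (φ x)) :=
      (Module.finrank_zero_iff (R := ℝ) (M := F)).1 hF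
    refine ⟨1, one_pos, fun v hv w _ => ?_⟩
    have h0 : v = 0 := inner_self_eq_zero (𝕜 := ℝ).1
      (hv v (LinearMap.mem_ker.2 (Subsingleton.elim _ _)))
    rw [h0, map_zero, inner_zero_left, inner_zero_left, mul_zero]
  · obtain ⟨ρ, -, hρ, hconf, -⟩ := h.exists_bound hF
    refine ⟨√(ρ x), Real.sqrt_pos.2 hρ, fun v hv w _ => ?_⟩
    rw [Real.sq_sqrt hρ.le, hconf v hv]

omit [FiniteDimensional ℝ F] [IsManifold 𝓘(ℝ, E) ∞ M] [IsManifold 𝓘(ℝ, F) ∞ N] in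
theorem IsConformalityFactor.sq_eq {φ : M → N} {x : M} {l r : ℝ}
    (hl : IsConformalityFactor 𝓘(ℝ, E) 𝓘(ℝ, F) φ x l)
    (hφ : Function.Surjective (mfderiv 𝓘(ℝ, E) 𝓘(ℝ, F) φ x)) (hF : 0 < Module.finrank ℝ F)
    (hr : ∀ v ∈ (LinearMap.ker (mfderiv 𝓘(ℝ, E) 𝓘(ℝ, F) φ x).toLinearMap)ᗮ,
      ∀ w : TangentSpace 𝓘(ℝ, E) x, r * ⟪v, w⟫ =
        ⟪mfderiv 𝓘(ℝ, E) 𝓘(ℝ, F) φ x v, mfderiv 𝓘(ℝ, E) 𝓘(ℝ, F) φ x w⟫) : l ^ 2 = r := by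
  have : Nontrivial (TangentSpace 𝓘(ℝ, F) (φ x)) :=
    Module.nontrivial_of_finrank_pos (R := ℝ) (M := F) hF
  obtain ⟨z, hz⟩ := exists_ne (0 : TangentSpace 𝓘(ℝ, F) (φ x))
  obtain ⟨w, hw, rfl⟩ := exists_horizontal_lift
    (L := (mfderiv 𝓘(ℝ, E) 𝓘(ℝ, F) φ x).toLinearMap) hφ z
  have hw0 : w ≠ 0 := fun h => hz (by rw [h, map_zero])
  exact mul_right_cancel₀ (inner_self_ne_zero.2 hw0) ((hl w hw w hw).trans (hr w hw w).symm)

variable [IsContMDiffRiemannianBundle 𝓘(ℝ, E) ∞ E (fun x : M => TangentSpace 𝓘(ℝ, E) x)]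
  [IsContMDiffRiemannianBundle 𝓘(ℝ, F) ∞ F (fun y : N => TangentSpace 𝓘(ℝ, F) y)]

/-- The part of the tension normal to the fibre-saturated submanifold `S` with tangent space `W`:
traced over an orthonormal basis of `Wᗮ`, the second fundamental form only sees the derivative of
the dilation. -/
theorem sum_inner_hessian_normal {φ : M → N} {x : M} (hφ : ContMDiffAt 𝓘(ℝ, E) 𝓘(ℝ, F) ∞ φ x)
    {ρ : M → ℝ} (hρ : MDifferentiableAt 𝓘(ℝ, E) 𝓘(ℝ, ℝ) ρ x)
    (hconf : ∀ v ∈ (LinearMap.ker (mfderiv 𝓘(ℝ, E) 𝓘(ℝ, F) φ x).toLinearMap)ᗮ,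
      ∀ w : TangentSpace 𝓘(ℝ, E) x, ρ x * ⟪v, w⟫ =
        ⟪mfderiv 𝓘(ℝ, E) 𝓘(ℝ, F) φ x v, mfderiv 𝓘(ℝ, E) 𝓘(ℝ, F) φ x w⟫)
    (hle : ∀ᶠ y in 𝓝 x, ∀ v : TangentSpace 𝓘(ℝ, E) y,
      ⟪mfderiv 𝓘(ℝ, E) 𝓘(ℝ, F) φ y v, mfderiv 𝓘(ℝ, E) 𝓘(ℝ, F) φ y v⟫ ≤ ρ y * ⟪v, v⟫)
    {V : Submodule ℝ (TangentSpace 𝓘(ℝ, E) x)}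
    (hV : V ≤ (LinearMap.ker (mfderiv 𝓘(ℝ, E) 𝓘(ℝ, F) φ x).toLinearMap)ᗮ)
    {w : TangentSpace 𝓘(ℝ, E) x} (hw : w ∈ V) :
    ∑ a, ⟪hessian 𝓘(ℝ, E) 𝓘(ℝ, F) φ x (stdOrthonormalBasis ℝ V a) (stdOrthonormalBasis ℝ V a),
        mfderiv 𝓘(ℝ, E) 𝓘(ℝ, F) φ x w⟫ =
      (1 - 2⁻¹ * (Module.finrank ℝ V : ℝ)) * mvfderiv 𝓘(ℝ, E) ρ x w := by
  set e := stdOrthonormalBasis ℝ V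
  have h1 : ∀ a, ⟪hessian 𝓘(ℝ, E) 𝓘(ℝ, F) φ x (e a) (e a), mfderiv 𝓘(ℝ, E) 𝓘(ℝ, F) φ x w⟫ =
      mvfderiv 𝓘(ℝ, E) ρ x (e a) * ⟪(e a : TangentSpace 𝓘(ℝ, E) x), w⟫
        - 2⁻¹ * mvfderiv 𝓘(ℝ, E) ρ x w := fun a => by
    have h2 : ⟪(e a : TangentSpace 𝓘(ℝ, E) x), (e a : TangentSpace 𝓘(ℝ, E) x)⟫ = 1 := by
      have h3 := real_inner_self_eq_norm_sq (e a)
      rw [e.orthonormal.1 a, one_pow] at h3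
      exact h3
    rw [inner_hessian_self_left hφ hρ hconf hle (hV (e a).2) (hV hw), h2, mul_one]
  have h4 : (∑ a, ⟪e a, (⟨w, hw⟩ : V)⟫ • e a : V) = ⟨w, hw⟩ := e.sum_repr' ⟨w, hw⟩
  have h5 : ∑ a, mvfderiv 𝓘(ℝ, E) ρ x (e a) * ⟪(e a : TangentSpace 𝓘(ℝ, E) x), w⟫ =
      mvfderiv 𝓘(ℝ, E) ρ x w := by
    have h6 := congrArg (fun z : V => mvfderiv 𝓘(ℝ, E) ρ x (z : TangentSpace 𝓘(ℝ, E) x)) h4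
    simp only [Submodule.coe_sum, Submodule.coe_smul, map_sum, map_smul, smul_eq_mul] at h6
    rw [← h6]
    exact Finset.sum_congr rfl fun a _ => mul_comm _ _
  simp only [h1, Finset.sum_sub_distrib, h5, Finset.sum_const, Finset.card_univ, Fintype.card_fin,
    nsmul_eq_mul]
  ring

theorem inner_pTension_eq {φ : M → N} (hφ : IsSubmersive 𝓘(ℝ, E) 𝓘(ℝ, F) φ) {p : ℕ} {B : Set N}
    (hB : IsSubmanifold 𝓘(ℝ, F) p B) {x : M} (hx : φ x ∈ B)
    (hconf : IsWHCFirstOrder 𝓘(ℝ, E) 𝓘(ℝ, F) φ x) {l : ℝ}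
    (hl : IsConformalityFactor 𝓘(ℝ, E) 𝓘(ℝ, F) φ x l) {Z : TangentSpace 𝓘(ℝ, F) (φ x)}
    (hZ : Z ∈ (tangentSpaceOf 𝓘(ℝ, F) B (φ x))ᗮ) :
    ⟪(normDiff 𝓘(ℝ, E) 𝓘(ℝ, F) φ x ^ ((p : ℝ) - 2))⁻¹ • pTension 𝓘(ℝ, E) 𝓘(ℝ, F) φ p x, Z⟫ =
      ⟪mfderiv 𝓘(ℝ, E) 𝓘(ℝ, F) φ x (meanCurvature 𝓘(ℝ, E) (φ ⁻¹' B) x), Z⟫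
        - ⟪l ^ 2 • meanCurvature 𝓘(ℝ, F) B (φ x), Z⟫ := by
  rcases Nat.eq_zero_or_pos (Module.finrank ℝ F) with hF | hF
  · have hsub : Subsingleton (TangentSpace 𝓘(ℝ, F) (φ x)) :=
      (Module.finrank_zero_iff (R := ℝ) (M := F)).1 hF
    rw [Subsingleton.elim Z 0]
    simp only [inner_zero_right, sub_zero]
  obtain ⟨ρ, hρ, hρ0, hρc, hle, hnorm, hlog⟩ := hconf.exists_bound hF
  have hlρ := hl.sq_eq (hφ.2 x) hF hρc
  have hS := hB.preimage hφ
  have hxS : x ∈ φ ⁻¹' B := hx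
  have hφx := hφ.1 x
  set L := (mfderiv 𝓘(ℝ, E) 𝓘(ℝ, F) φ x).toLinearMap with hL
  set W := tangentSpaceOf 𝓘(ℝ, E) (φ ⁻¹' B) x with hWdef
  have hW : W = (tangentSpaceOf 𝓘(ℝ, F) B (φ x)).comap L := tangentSpaceOf_preimage hB hφ hx
  have hkerW : LinearMap.ker L ≤ W := fun v hv => by
    rw [hW, Submodule.mem_comap, LinearMap.mem_ker.1 hv]
    exact zero_mem _
  have hWo : Wᗮ ≤ (LinearMap.ker L)ᗮ := Submodule.orthogonal_le hkerW
  obtain ⟨w, hw, hwZ⟩ := exists_horizontal_lift (L := L) (hφ.2 x) Z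
  have hwW : w ∈ Wᗮ := by
    intro v hv
    rw [hW] at hv
    have h1 := hZ _ hv
    rw [← hwZ, inner_map_of_horizontal hl v hw, hlρ] at h1
    exact (mul_eq_zero.1 h1).resolve_left hρ0.ne'
  obtain ⟨c, hc, hcB, hcZ⟩ := hB.exists_normal_function hx hZ
  have hcφ : ContMDiffAt 𝓘(ℝ, E) 𝓘(ℝ, ℝ) ∞ (fun y => c (φ y)) x := hc.comp x hφx
  obtain ⟨X, hX, hXW, hXc⟩ := (isMeanCurvature_meanCurvature hS hxS).exists_orthonormal hxS
  obtain ⟨Y, hY, hYW, hYc⟩ := (isMeanCurvature_meanCurvature hB hx).exists_orthonormal hx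
  let A : TangentSpace 𝓘(ℝ, E) x →ₗ[ℝ] TangentSpace 𝓘(ℝ, E) x →ₗ[ℝ] ℝ :=
    hessForm hcφ - (hessForm hc).compl₁₂ L L
  have hA : ∀ v, A v v = ⟪hessian 𝓘(ℝ, E) 𝓘(ℝ, F) φ x v v, Z⟫ := fun v => by
    rw [← hcZ]
    have h1 : A v v = hessFun (fun y => c (φ y)) x v v - hessFun c (φ x) (L v) (L v) := rfl
    rw [h1, hessFun_comp hφ.1 hc]
    exact add_sub_cancel_left _ _
  have hτ : ⟪tension 𝓘(ℝ, E) 𝓘(ℝ, F) φ x, Z⟫ =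
      ∑ j, A (X j) (X j) + (1 - 2⁻¹ * (p : ℝ)) * mvfderiv 𝓘(ℝ, E) ρ x w := by
    have h1 := sum_inner_hessian_normal hφx hρ hρc hle hWo hwW
    have hp : Module.finrank ℝ Wᗮ = p := hS.finrank_orthogonal_tangentSpaceOf hxS
    rw [← hp, ← h1, tension, sum_inner]
    simp only [← hA]
    rw [sum_bilin_add_orthogonal A _ hX hXW]
    refine congrArg _ (Finset.sum_congr rfl fun a _ => ?_)
    rw [hA, ← hwZ]
    rfl
  have hH : ⟪L (meanCurvature 𝓘(ℝ, E) (φ ⁻¹' B) x), Z⟫ =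
      ∑ j, A (X j) (X j) + l ^ 2 * ⟪meanCurvature 𝓘(ℝ, F) B (φ x), Z⟫ := by
    have h1 := hXc _ hcφ (hφx.continuousAt.eventually hcB)
    have h2 := mvfderiv_comp_mfderiv (hc.mdifferentiableAt (by simp))
      (hφx.mdifferentiableAt (by simp)) (meanCurvature 𝓘(ℝ, E) (φ ⁻¹' B) x)
    rw [h2, hcZ] at h1
    have h3 := hYc c hc hcB
    rw [hcZ] at h3
    have h4 := sum_bilin_map_eq (L := L) (hφ.2 x) hl (hessForm hc) hW hX hXW hY hYW
    have h5 : ∑ k, hessFun c (φ x) (Y k) (Y k) = ∑ k, hessForm hc (Y k) (Y k) := rfl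
    have h6 : ∀ j, A (X j) (X j) = hessFun (fun y => c (φ y)) x (X j) (X j)
      - hessForm hc (L (X j)) (L (X j)) := fun _ => rfl
    rw [h3, h5, ← h4]
    simp only [h6, Finset.sum_sub_distrib]
    exact h1.trans (sub_add_cancel _ _).symm
  have hgrad : ⟪L (grad 𝓘(ℝ, E) (fun y => Real.log (normDiff 𝓘(ℝ, E) 𝓘(ℝ, F) φ y)) x), Z⟫ =
      2⁻¹ * mvfderiv 𝓘(ℝ, E) ρ x w := by
    rw [← hwZ, inner_map_of_horizontal hl _ hw, inner_grad, hlρ, ← hlog]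
    ring
  have hne : normDiff 𝓘(ℝ, E) 𝓘(ℝ, F) φ x ^ ((p : ℝ) - 2) ≠ 0 := (Real.rpow_pos_of_pos hnorm _).ne'
  rw [pTension, inv_smul_smul₀ hne, inner_add_left, real_inner_smul_left, real_inner_smul_left]
  refine Eq.trans ?_ (congrArg (· - l ^ 2 * ⟪meanCurvature 𝓘(ℝ, F) B (φ x), Z⟫) hH).symm
  rw [hτ]
  refine (congrArg (fun t => _ + ((p : ℝ) - 2) * t) hgrad).trans ?_
  ring

end FundamentalEquation

end RiemMap

theorem mainTheorem5 {m n : ℕ}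
    {M : Type*} [TopologicalSpace M] [ChartedSpace (EuclideanSpace ℝ (Fin m)) M]
    [IsManifold (𝓡 m) ∞ M] [RiemannianBundle (fun x : M => TangentSpace (𝓡 m) x)]
    [IsContMDiffRiemannianBundle (𝓡 m) ∞ (EuclideanSpace ℝ (Fin m))
      (fun x : M => TangentSpace (𝓡 m) x)]
    {N : Type*} [TopologicalSpace N] [ChartedSpace (EuclideanSpace ℝ (Fin n)) N]
    [IsManifold (𝓡 n) ∞ N] [RiemannianBundle (fun y : N => TangentSpace (𝓡 n) y)]
    [IsContMDiffRiemannianBundle (𝓡 n) ∞ (EuclideanSpace ℝ (Fin n))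
      (fun y : N => TangentSpace (𝓡 n) y)]
    (φ : M → N) (hφ : RiemMap.IsSubmersive (𝓡 m) (𝓡 n) φ)
    (p : ℕ) (B : Set N) (hB : RiemMap.IsSubmanifold (𝓡 n) p B)
    (x : M) (hx : x ∈ φ ⁻¹' B) (hconf : RiemMap.IsWHCFirstOrder (𝓡 m) (𝓡 n) φ x) :
    RiemMap.IsSubmanifold (𝓡 m) p (φ ⁻¹' B) ∧
    (∃ l : ℝ, 0 < l ∧ RiemMap.IsConformalityFactor (𝓡 m) (𝓡 n) φ x l) ∧
    ∀ l : ℝ, RiemMap.IsConformalityFactor (𝓡 m) (𝓡 n) φ x l →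
      ∀ Z ∈ (RiemMap.tangentSpaceOf (𝓡 n) B (φ x))ᗮ,
        inner ℝ ((RiemMap.normDiff (𝓡 m) (𝓡 n) φ x ^ ((p : ℝ) - 2))⁻¹ •
            RiemMap.pTension (𝓡 m) (𝓡 n) φ p x) Z
          = inner ℝ (mfderiv (𝓡 m) (𝓡 n) φ x
              (RiemMap.meanCurvature (𝓡 m) (φ ⁻¹' B) x)) Z
            - inner ℝ (l ^ 2 • RiemMap.meanCurvature (𝓡 n) B (φ x)) Z := by
  exact ⟨hB.preimage hφ, hconf.exists_isConformalityFactor,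
    fun _ hl _ hZ => RiemMap.inner_pTension_eq hφ hB hx hconf hl hZ⟩
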